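/- All sets are finite. A closure system over a finite set $U$ is a family $\mathcal{C}$ of subsets of $U$ with $U\in\mathcal{C}$ that is closed under intersection; its members are called closed, $\mathrm{cl}(A)=\bigcap\{F\in\mathcal{C} : A\subseteq F\}$, $\mathrm{cl}(a)=\mathrm{cl}(\{a\})$, and $\mathrm{cl}^b(A)=\bigcup_{a\in A}\mathrm{cl}(a)$. It is standard if $\mathrm{cl}(a)\setminus\{a\}$ is closed for every $a\in U$, and distributive if it is closed under union. A closed set $M\neq U$ is meet-irreducible if $F_1\cap F_2=M$ with $F_1,F_2\in\mathcal{C}$ implies $F_1=M$ or $F_2=M$. A set $A\subseteq U$ is a minimal generator of $c\in U$ if $c\in\mathrm{cl}(A)$ and $c\notin\mathrm{cl}(A')$ for all $A'\subsetneq A$; it is a $D$-generator of $c$ if moreover $c\notin\mathrm{cl}^b(A)$ and every minimal generator $A'$ of $c$ with $A'\subseteq\mathrm{cl}^b(A)$ equals $A$. The $D$-base of $\mathcal{C}$ consists of the implications $\{a\}\to c$ with $c\in\mathrm{cl}(a)\setminus\{a\}$ and the implications $A\to c$ with $A$ a $D$-generator of $c$. An implicational base over $U$ is a set $\Sigma$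 of implications $A\to c$ ($A\subseteq U$, $c\in U$); the closed sets of its closure system are the $F\subseteq U$ such that $A\subseteq F$ implies $c\in F$ for all $A\to c$ in $\Sigma$. Two antichains $\mathcal{B}^-,\mathcal{B}^+$ of $(\mathcal{C},\subseteq)$ are dual if every closed set contains a member of $\mathcal{B}^-$ or is contained in a member of $\mathcal{B}^+$, and no closed set does both. An algorithm for an enumeration problem runs in output-polynomial time if its running time is bounded by a polynomial in the size of the input plus the size of the output; the output is a list, without repetitions, of all solutions. Theorem. The following are equivalent. (1) There is an output-polynomial time algorithm that, given (a ground set $U$ and) the meet-irreducible elements of a standard closure system over $U$, computes its $D$-base. (2) There is an output-polynomial time algorithm for dualization in distributive lattices: given an implicational base of a standard distributive closure system $\mathcal{C}$ over $U$ and an antichain $\mathcal{B}^+$ of $(\mathcal{C},\subseteq)$, compute the antichain $\mathcal{B}^-$ dual to $\mathcal{B}^+$ in $(\mathcal{C},\subseteq)$. -/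

import Mathlib

/-! ### Closure systems on a finite ground set, and the `D`-base -/

namespace ClosureSys

variable {U : Type} [Fintype U] [DecidableEq U]

/-- `C` is (the family of closed sets of) a closure system over the ground set `U`. -/
def IsClosureSystem (C : Finset (Finset U)) : Prop :=
  Finset.univ ∈ C ∧ ∀ F₁ ∈ C, ∀ F₂ ∈ C, F₁ ∩ F₂ ∈ C

/-- The closure operator of `C`: the intersection of all closed sets that contain `A`. -/
def cl (C : Finset (Finset U)) (A : Finset U) : Finset U :=
  (C.filter (fun F => A ⊆ F)).inf id

/-- The operator `cl^b`: the union of the closures of the elements of `A`. -/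
def clb (C : Finset (Finset U)) (A : Finset U) : Finset U :=
  A.biUnion (fun a => cl C {a})

/-- `C` is standard: `cl(a) \ {a}` is closed for every element `a`. -/
def IsStandard (C : Finset (Finset U)) : Prop :=
  ∀ a : U, cl C {a} \ {a} ∈ C

/-- `C` is distributive: it is closed under unions. -/
def IsDistributive (C : Finset (Finset U)) : Prop :=
  ∀ F₁ ∈ C, ∀ F₂ ∈ C, F₁ ∪ F₂ ∈ C

/-- The meet-irreducible elements of `C`. -/
def meetIrreducibles (C : Finset (Finset U)) : Finset (Finset U) :=
  C.filter (fun M => M ≠ Finset.univ ∧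
    ∀ F₁ ∈ C, ∀ F₂ ∈ C, F₁ ∩ F₂ = M → F₁ = M ∨ F₂ = M)

/-- `A` is a minimal generator of `c`. -/
def IsMinGen (C : Finset (Finset U)) (A : Finset U) (c : U) : Prop :=
  c ∈ cl C A ∧ ∀ A', A' ⊂ A → c ∉ cl C A'

/-- `A` is a `D`-generator of `c`. -/
def IsDGen (C : Finset (Finset U)) (A : Finset U) (c : U) : Prop :=
  IsMinGen C A c ∧ c ∉ clb C A ∧ ∀ A', IsMinGen C A' c → A' ⊆ clb C A → A' = A

/-- An implication `A → c` is represented by the pair `(A, c)`. -/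
abbrev Implication (U : Type) : Type := Finset U × U

/-- The `D`-base of `C`: the binary implications `a → c` with `c ∈ cl(a) \ {a}`, and the
implications `A → c` with `A` a `D`-generator of `c`. -/
def dBase (C : Finset (Finset U)) : Set (Implication U) :=
  {i | ∃ a c : U, c ∈ cl C {a} \ {a} ∧ i = ({a}, c)} ∪
    {i | ∃ (A : Finset U) (c : U), IsDGen C A c ∧ i = (A, c)}

/-- The closed sets of the implicational base that consists of the implications in `S`. -/
def closedSets (S : List (Implication U)) : Finset (Finset U) :=
  Finset.univ.filter (fun F => ∀ i ∈ S, i.1 ⊆ F → i.2 ∈ F)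

/-- `B` is an antichain of the lattice `(C, ⊆)`. -/
def IsAntichainOf (C : Finset (Finset U)) (B : Set (Finset U)) : Prop :=
  (∀ F ∈ B, F ∈ C) ∧ IsAntichain (· ⊆ ·) B

/-- The order ideal of `B` in `(C, ⊆)`. -/
def ideal (C : Finset (Finset U)) (B : Set (Finset U)) : Set (Finset U) :=
  {F | F ∈ C ∧ ∃ G ∈ B, F ⊆ G}

/-- The order filter of `B` in `(C, ⊆)`. -/
def orderFilter (C : Finset (Finset U)) (B : Set (Finset U)) : Set (Finset U) :=
  {F | F ∈ C ∧ ∃ G ∈ B, G ⊆ F}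

/-- `Bm` and `Bp` are dual antichains of `(C, ⊆)`. -/
def AreDual (C : Finset (Finset U)) (Bm Bp : Set (Finset U)) : Prop :=
  IsAntichainOf C Bm ∧ IsAntichainOf C Bp ∧
    orderFilter C Bm ∪ ideal C Bp = (C : Set (Finset U)) ∧
    orderFilter C Bm ∩ ideal C Bp = ∅

end ClosureSys

/-! ### The model of computation: `while` programs on binary trees

This is the textbook language WHILE over LISP data. A program has finitely many variables, each of
which holds a binary tree. Every evaluation of an expression is charged with the sizes of the values
of all its subexpressions (so no data are copied for free), and every command is charged one unit
more. Hence the running time is polynomially related to that of multi-tape Turing machines. -/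

namespace WhileProg

/-- The data: binary trees, the pure S-expressions over the single atom `nil`. -/
inductive Data : Type
  | nil : Data
  | cons : Data → Data → Data

namespace Data

/-- The number of nodes of a tree. -/
def size : Data → ℕ
  | nil => 1
  | cons l r => l.size + r.size + 1

/-- Left subtree. -/
def head : Data → Data
  | nil => nil
  | cons l _ => l

/-- Right subtree. -/
def tail : Data → Data
  | nil => nil
  | cons _ r => r

end Data

/-- The content of the variables. -/
abbrev Store : Type := ℕ → Data

/-- Expressions. -/
inductive Term : Type
  | var : ℕ → Term
  | nil : Term
  | cons : Term → Term → Term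
  | head : Term → Term
  | tail : Term → Term

namespace Term

/-- The value of an expression. -/
def eval (s : Store) : Term → Data
  | var x => s x
  | nil => Data.nil
  | cons e f => Data.cons (e.eval s) (f.eval s)
  | head e => (e.eval s).head
  | tail e => (e.eval s).tail

/-- The time to evaluate an expression: the total size of the values of all its subexpressions. -/
def cost (s : Store) : Term → ℕ
  | var x => (s x).size
  | nil => 1
  | cons e f => e.cost s + f.cost s + ((cons e f).eval s).size
  | head e => e.cost s + ((head e).eval s).size
  | tail e => e.cost s + ((tail e).eval s).size

end Term

/-- Programs. In `cond` and `loop`, the value `nil` of the guard stands for "false", and every other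
value for "true". -/
inductive Program : Type
  | assign : ℕ → Term → Program
  | seq : Program → Program → Program
  | cond : Term → Program → Program → Program
  | loop : Term → Program → Program

/-- `Exec P s t s'`: started in the store `s`, the program `P` halts after time `t` in the
store `s'`. -/
inductive Exec : Program → Store → ℕ → Store → Prop
  | assign (x : ℕ) (e : Term) (s : Store) :
      Exec (.assign x e) s (1 + e.cost s) (Function.update s x (e.eval s))
  | seq {P Q : Program} {s s' s'' : Store} {t t' : ℕ} :
      Exec P s t s' → Exec Q s' t' s'' → Exec (.seq P Q) s (1 + t + t') s''
  | cond_true {e : Term} {P Q : Program} {s s' : Store} {t : ℕ} :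
      e.eval s ≠ Data.nil → Exec P s t s' → Exec (.cond e P Q) s (1 + e.cost s + t) s'
  | cond_false {e : Term} {P Q : Program} {s s' : Store} {t : ℕ} :
      e.eval s = Data.nil → Exec Q s t s' → Exec (.cond e P Q) s (1 + e.cost s + t) s'
  | loop_done {e : Term} {P : Program} {s : Store} :
      e.eval s = Data.nil → Exec (.loop e P) s (1 + e.cost s) s
  | loop_step {e : Term} {P : Program} {s s' s'' : Store} {t t' : ℕ} :
      e.eval s ≠ Data.nil → Exec P s t s' → Exec (.loop e P) s' t' s'' →
        Exec (.loop e P) s (1 + e.cost s + t + t') s''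

/-- The initial store: the input is in variable `0`, all other variables are `nil`. -/
def initStore (x : Data) : Store := fun i => if i = 0 then x else Data.nil

/-- On input `x`, the program `P` halts after time `t` with output `y` (in variable `0`). -/
def Outputs (P : Program) (x y : Data) (t : ℕ) : Prop :=
  ∃ s, Exec P (initStore x) t s ∧ s 0 = y

/-! ### Encodings -/

/-- A list of trees as a tree. -/
def encList : List Data → Data
  | [] => Data.nil
  | d :: l => Data.cons d (encList l)

/-- A natural number in unary. -/
def encNat (n : ℕ) : Data := encList (List.replicate n Data.nil)

/-- A truth value. -/
def encBool : Bool → Data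
  | false => Data.nil
  | true => Data.cons Data.nil Data.nil

/-- A subset of `{0, …, n - 1}` by its characteristic vector. -/
def encSet {n : ℕ} (A : Finset (Fin n)) : Data :=
  encList (List.ofFn (fun i : Fin n => encBool (decide (i ∈ A))))

/-- An implication over `{0, …, n - 1}`. -/
def encImplication {n : ℕ} (i : ClosureSys.Implication (Fin n)) : Data :=
  Data.cons (encSet i.1) (encNat i.2)

/-! ### Enumeration problems and output-polynomial time -/

/-- An enumeration problem: to each instance belongs a finite set of items that has to be listed. -/
structure EnumProblem where
  /-- The instances. -/
  Inst : Type
  /-- How an instance is given to the program. -/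
  encInst : Inst → Data
  /-- The items among which the solutions of an instance are found. -/
  Item : Inst → Type
  /-- How an item is written. -/
  encItem : (i : Inst) → Item i → Data
  /-- `IsAnswer i S`: the set to be listed for the instance `i` is `S`. -/
  IsAnswer : (i : Inst) → Set (Item i) → Prop

/-- There is an algorithm that solves the problem in output-polynomial time: on every instance it
outputs a list, without repetitions and in any order, of the items of the answer, and its running
time is bounded by a polynomial in the size of the input plus the size of the output. -/
def EnumProblem.OutputPolynomial (Q : EnumProblem) : Prop :=
  ∃ (P : Program) (p : Polynomial ℕ), ∀ i : Q.Inst, ∃ (L : List (Q.Item i)) (t : ℕ),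
    L.Nodup ∧ Q.IsAnswer i {y | y ∈ L} ∧
    Outputs P (Q.encInst i) (encList (L.map (Q.encItem i))) t ∧
    t ≤ p.eval ((Q.encInst i).size + (encList (L.map (Q.encItem i))).size)

end WhileProg

/-! ### The two problems -/

open ClosureSys WhileProg

/-- An instance of the `D`-base computation: a list, without repetitions and in any order, of the
meet-irreducible elements of a standard closure system over `{0, …, n - 1}`. -/
structure MeetInstance where
  n : ℕ
  closedFamily : Finset (Finset (Fin n))
  isClosureSystem : IsClosureSystem closedFamily
  isStandard : IsStandard closedFamily
  meets : List (Finset (Fin n))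
  meets_nodup : meets.Nodup
  mem_meets : ∀ M, M ∈ meets ↔ M ∈ meetIrreducibles closedFamily

/-- Given the ground set and the meet-irreducible elements (and nothing else) of a standard closure
system, list its `D`-base. -/
def dBaseFromMeetIrreducibles : EnumProblem where
  Inst := MeetInstance
  encInst i := Data.cons (encNat i.n) (encList (i.meets.map encSet))
  Item i := Implication (Fin i.n)
  encItem _ := encImplication
  IsAnswer i S := S = dBase i.closedFamily

/-- An instance of dualization: an implicational base of a standard distributive closure system
over `{0, …, n - 1}`, and an antichain `Bp` of its lattice of closed sets, both given as lists
without repetitions and in any order. -/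
structure DualInstance where
  n : ℕ
  base : List (Implication (Fin n))
  base_nodup : base.Nodup
  isStandard : IsStandard (closedSets base)
  isDistributive : IsDistributive (closedSets base)
  Bp : List (Finset (Fin n))
  Bp_nodup : Bp.Nodup
  isAntichain : IsAntichainOf (closedSets base) {B | B ∈ Bp}

/-- Given an implicational base of a standard distributive closure system and an antichain of its
lattice, list the dual antichain. -/
def distributiveDualization : EnumProblem where
  Inst := DualInstance
  encInst i := Data.cons (encNat i.n)
    (Data.cons (encList (i.base.map encImplication)) (encList (i.Bp.map encSet)))
  Item i := Finset (Fin i.n)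
  encItem _ := encSet
  IsAnswer i Bm := AreDual (closedSets i.base) Bm {B | B ∈ i.Bp}

/-! ### A calculus of polynomial-time computable functions -/

namespace WhileProg

open Polynomial

/-! Order the ground set of a standard system by letting b lie below a when b ∈ cl(a). The order
ideals form a standard distributive closure system with the same principal closures. Since
cl(cl^b(A)) = cl(A), the map A ↦ cl^b(A), with inverse "take the maximal elements", matches the
D-generators of c with the minimal ideals F such that c ∈ cl(F) and c ∉ F
(`IsMinDown.isDGen_maxElts`, `IsDGen.maxElts_clb`).

Dualization yields the D-base: c ∈ cl(F) holds exactly when F lies in none of the maximal closed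
sets avoiding c. These are meet-irreducible, hence can be read off the input, and dualizing them in
the lattice of ideals lists the minimal ideals generating c. Only one of these, cl(c), can contain
c, so no call returns much more than the D-base itself
(`IsClosureSystem.length_le_length_dBaseList`).

The D-base yields dualization: adjoin a point 0 to the distributive system, declare F ∪ {0} closed
for every closed F, and keep F closed without 0 only if it lies below B⁺. Then 0 belongs to the
closure of a set of old points exactly when their old closure escapes the ideal of B⁺. The
meet-irreducibles are explicit (`mem_coneMeets_iff`). By distributivity old points have no
D-generators; those of 0 generate minimal closed sets outside the ideal, and every other such
minimal set is principal and comes from a binary implication a → 0. Only quadratically many binary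
implications exist, so the D-base is not much larger than the dual antichain
(`length_le_length_coneDual`). An empty B⁺ would destroy standardness and is treated apart.

The running times are handled by `PolyTime`, which is closed under composition, branching and
size-bounded folds. Its parameter `sz` is instantiated by the output size
(`EnumProblem.outputPolynomial_iff`), and `PolyTime.mono` trades the output size of a subroutine for
that of the whole algorithm. -/

theorem eval_mono (p : ℕ[X]) {m n : ℕ} (h : m ≤ n) : p.eval m ≤ p.eval n := by
  induction p using Polynomial.induction_on' with
  | add p q hp hq => simpa using Nat.add_le_add hp hq
  | monomial k c => simpa using Nat.mul_le_mul_left c (Nat.pow_le_pow_left h k)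

/-! ### Locality of programs and growth of data -/

/-- A strict bound on the variables of an expression. -/
def Term.bound : Term → ℕ
  | var x => x + 1
  | nil => 0
  | cons e f => max e.bound f.bound
  | head e => e.bound
  | tail e => e.bound

/-- A strict bound on the variables of a program. -/
def Program.bound : Program → ℕ
  | assign x e => max (x + 1) e.bound
  | seq P Q => max P.bound Q.bound
  | cond e P Q => max e.bound (max P.bound Q.bound)
  | loop e P => max e.bound P.bound

theorem Term.eval_congr {s r : Store} : ∀ {e : Term}, (∀ x < e.bound, s x = r x) →
    e.eval s = e.eval r
  | var x, h => h x (Nat.lt_succ_self x)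
  | nil, _ => rfl
  | cons e f, h => by
      have he := Term.eval_congr (e := e) fun x hx => h x (lt_max_of_lt_left hx)
      have hf := Term.eval_congr (e := f) fun x hx => h x (lt_max_of_lt_right hx)
      simp [Term.eval, he, hf]
  | head e, h => by simp [Term.eval, Term.eval_congr (e := e) h]
  | tail e, h => by simp [Term.eval, Term.eval_congr (e := e) h]

theorem Term.cost_congr {s r : Store} : ∀ {e : Term}, (∀ x < e.bound, s x = r x) →
    e.cost s = e.cost r
  | var x, h => by simp [Term.cost, h x (Nat.lt_succ_self x)]
  | nil, _ => rfl
  | cons e f, h => by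
      have he := Term.cost_congr (e := e) fun x hx => h x (lt_max_of_lt_left hx)
      have hf := Term.cost_congr (e := f) fun x hx => h x (lt_max_of_lt_right hx)
      simp only [Term.cost, he, hf, Term.eval_congr h]
  | head e, h => by
      simp only [Term.cost, Term.cost_congr (e := e) h, Term.eval_congr (e := head e) h]
  | tail e, h => by
      simp only [Term.cost, Term.cost_congr (e := e) h, Term.eval_congr (e := tail e) h]

/-- A program leaves the variables that it does not mention unchanged. -/
theorem Exec.frame {P : Program} {s s' : Store} {t : ℕ} (h : Exec P s t s') :
    ∀ x, P.bound ≤ x → s' x = s x := by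
  induction h with
  | assign y e s =>
    intro x hx
    simp only [Program.bound, sup_le_iff] at hx
    rw [Function.update_of_ne (by omega)]
  | seq _ _ ih₁ ih₂ =>
    intro x hx
    simp only [Program.bound, sup_le_iff] at hx
    rw [ih₂ x hx.2, ih₁ x hx.1]
  | cond_true _ _ ih =>
    intro x hx
    simp only [Program.bound, sup_le_iff] at hx
    exact ih x hx.2.1
  | cond_false _ _ ih =>
    intro x hx
    simp only [Program.bound, sup_le_iff] at hx
    exact ih x hx.2.2
  | loop_done _ => intro x _; rfl
  | loop_step _ _ _ ih₁ ih₂ =>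
    intro x hx
    rw [ih₂ x hx]
    simp only [Program.bound, sup_le_iff] at hx
    exact ih₁ x hx.2

/-- A run depends only on the variables that the program mentions. -/
theorem Exec.congr {P : Program} {s s' : Store} {t : ℕ} (h : Exec P s t s') {N : ℕ} :
    P.bound ≤ N → ∀ r : Store, (∀ x < N, s x = r x) →
      ∃ r', Exec P r t r' ∧ ∀ x < N, s' x = r' x := by
  induction h with
  | assign y e s =>
    intro hN r hr
    simp only [Program.bound, sup_le_iff] at hN
    have hr' : ∀ x < e.bound, s x = r x := fun x hx => hr x (by omega)
    refine ⟨_, by rw [Term.cost_congr hr']; exact .assign y e r, fun x hx => ?_⟩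
    by_cases hxy : x = y
    · subst hxy; simp [Term.eval_congr hr']
    · simp [Function.update_of_ne hxy, hr x hx]
  | seq _ _ ih₁ ih₂ =>
    intro hN r hr
    simp only [Program.bound, sup_le_iff] at hN
    obtain ⟨r₁, h₁, hr₁⟩ := ih₁ hN.1 r hr
    obtain ⟨r₂, h₂, hr₂⟩ := ih₂ hN.2 r₁ hr₁
    exact ⟨r₂, .seq h₁ h₂, hr₂⟩
  | @cond_true e _ _ _ _ _ he _ ih =>
    intro hN r hr
    simp only [Program.bound, sup_le_iff] at hN
    have hr' := fun x (hx : x < e.bound) => hr x (by omega)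
    obtain ⟨r₁, h₁, hr₁⟩ := ih hN.2.1 r hr
    exact ⟨r₁, by
      rw [Term.cost_congr hr']
      exact .cond_true (by rwa [← Term.eval_congr hr']) h₁, hr₁⟩
  | @cond_false e _ _ _ _ _ he _ ih =>
    intro hN r hr
    simp only [Program.bound, sup_le_iff] at hN
    have hr' := fun x (hx : x < e.bound) => hr x (by omega)
    obtain ⟨r₁, h₁, hr₁⟩ := ih hN.2.2 r hr
    exact ⟨r₁, by
      rw [Term.cost_congr hr']
      exact .cond_false (by rwa [← Term.eval_congr hr']) h₁, hr₁⟩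
  | @loop_done e _ _ he =>
    intro hN r hr
    simp only [Program.bound, sup_le_iff] at hN
    have hr' := fun x (hx : x < e.bound) => hr x (by omega)
    exact ⟨r, by
      rw [Term.cost_congr hr']
      exact .loop_done (by rwa [← Term.eval_congr hr']), hr⟩
  | @loop_step e _ _ _ _ _ _ he _ _ ih₁ ih₂ =>
    intro hN r hr
    obtain ⟨r₁, h₁, hr₁⟩ := ih₁ (le_trans (le_max_right _ _) hN) r hr
    obtain ⟨r₂, h₂, hr₂⟩ := ih₂ hN r₁ hr₁
    simp only [Program.bound, sup_le_iff] at hN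
    have hr' := fun x (hx : x < e.bound) => hr x (by omega)
    exact ⟨r₂, by
      rw [Term.cost_congr hr']
      exact .loop_step (by rwa [← Term.eval_congr hr']) h₁ h₂, hr₂⟩

theorem Term.size_eval_le_cost (s : Store) (e : Term) : (e.eval s).size ≤ e.cost s := by
  cases e <;> simp [Term.cost, Term.eval, Data.size]

/-- The data grow by at most the running time. -/
theorem Exec.size_le {P : Program} {s s' : Store} {t : ℕ} (h : Exec P s t s') (x : ℕ) :
    (s' x).size ≤ (s x).size + t := by
  induction h with
  | assign y e s =>
    by_cases hxy : x = y
    · subst hxy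
      have := e.size_eval_le_cost s
      simp only [Function.update_self]; omega
    · simp [Function.update_of_ne hxy]
  | seq _ _ ih₁ ih₂ => omega
  | cond_true _ _ ih => omega
  | cond_false _ _ ih => omega
  | loop_done _ => omega
  | loop_step _ _ _ ih₁ ih₂ => omega

/-! ### Runs with a time bound and a postcondition -/

/-- Started in `s`, the program `P` halts within time `T` in a store with the property `post`. -/
def Runs (P : Program) (s : Store) (T : ℕ) (post : Store → Prop) : Prop :=
  ∃ t s', Exec P s t s' ∧ t ≤ T ∧ post s'

theorem Runs.assign {x : ℕ} {e : Term} {s : Store} {T : ℕ} {post : Store → Prop}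
    (hT : 1 + e.cost s ≤ T) (h : post (Function.update s x (e.eval s))) :
    Runs (.assign x e) s T post :=
  ⟨_, _, .assign x e s, hT, h⟩

theorem Runs.seq {P Q : Program} {s : Store} {T₁ T₂ : ℕ} {post : Store → Prop}
    (h : Runs P s T₁ fun s' => Runs Q s' T₂ post) : Runs (.seq P Q) s (1 + T₁ + T₂) post := by
  obtain ⟨t₁, s₁, h₁, ht₁, t₂, s₂, h₂, ht₂, h⟩ := h
  exact ⟨_, s₂, .seq h₁ h₂, by omega, h⟩

theorem Runs.mono {P : Program} {s : Store} {T T' : ℕ} {post post' : Store → Prop}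
    (h : Runs P s T post) (hT : T ≤ T') (hp : ∀ s', post s' → post' s') :
    Runs P s T' post' := by
  obtain ⟨t, s', h, ht, hs⟩ := h
  exact ⟨t, s', h, ht.trans hT, hp s' hs⟩

/-- A round costs at most `T` for the guard, `T` for the body and one unit more; the extra round in
`n + 1` pays for the final, failing test. The invariant is indexed by the number of completed
rounds. -/
theorem Runs.loop {e : Term} {P : Program} {T n : ℕ} (I : ℕ → Store → Prop)
    (hstep : ∀ k < n, ∀ s, I k s → e.eval s ≠ .nil ∧ e.cost s ≤ T ∧ Runs P s T (I (k + 1)))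
    (hdone : ∀ s, I n s → e.eval s = .nil ∧ e.cost s ≤ T) {s : Store} (hs : I 0 s) :
    Runs (.loop e P) s ((n + 1) * (2 * T + 1)) (I n) := by
  suffices H : ∀ j k, k + j = n → ∀ s, I k s →
      Runs (.loop e P) s ((j + 1) * (2 * T + 1)) (I n) from H n 0 (by omega) s hs
  intro j
  induction j with
  | zero =>
    intro k hk s hs
    obtain rfl : k = n := by omega
    obtain ⟨h₁, h₂⟩ := hdone s hs
    exact ⟨_, s, .loop_done h₁, by omega, hs⟩
  | succ j ih =>
    intro k hk s hs
    obtain ⟨h₁, h₂, t, s₁, hP, ht, hs₁⟩ := hstep k (by omega) s hs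
    obtain ⟨t', s₂, hL, ht', hs₂⟩ := ih (k + 1) (by omega) s₁ hs₁
    refine ⟨_, s₂, .loop_step h₁ hP hL, ?_, hs₂⟩
    rw [show (j + 1 + 1) * (2 * T + 1) = (j + 1) * (2 * T + 1) + (2 * T + 1) by ring]
    omega

/-! ### Polynomial-time functions and their basic combinators -/

/-- `out a` can be computed from `inp a`, for every parameter `a`, in time polynomial in
`sz a + (inp a).size`. Input and output are in variable `0`, the other variables may have any
initial values. -/
def PolyTime {α : Type*} (sz : α → ℕ) (inp out : α → Data) : Prop :=
  ∃ (P : Program) (p : ℕ[X]), ∀ a s, s 0 = inp a →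
    Runs P s (p.eval (sz a + (inp a).size)) fun s' => s' 0 = out a

namespace PolyTime

variable {α : Type*} {sz : α → ℕ} {inp f g out : α → Data}

/-- The form in which the combinators use a subroutine: one polynomial bounds both time and output
size, it may be evaluated at any upper bound `m`, and variables beyond `P.bound` survive and can
serve as registers. -/
theorem exists_program (h : PolyTime sz inp out) :
    ∃ (P : Program) (p : ℕ[X]), ∀ a m, sz a + (inp a).size ≤ m → (out a).size ≤ p.eval m ∧
      ∀ s, s 0 = inp a →
        Runs P s (p.eval m) fun s' => s' 0 = out a ∧ ∀ x, P.bound ≤ x → s' x = s x := by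
  obtain ⟨P, p, h⟩ := h
  refine ⟨P, p + X, fun a m hm => ⟨?_, fun s hs => ?_⟩⟩
  -- Any store with the input in variable `0` will do: the output is at most the input plus the
  -- running time.
  · obtain ⟨t, s', hE, ht, hs'⟩ := h a (fun _ => inp a) rfl
    have := hE.size_le 0
    have := eval_mono p hm
    simp only [eval_add, eval_X, ← hs'] at *
    omega
  · obtain ⟨t, s', hE, ht, hs'⟩ := h a s hs
    have := eval_mono p hm
    refine ⟨t, s', hE, ?_, hs', hE.frame⟩
    simp only [eval_add]
    omega

theorem size_le (h : PolyTime sz inp out) :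
    ∃ p : ℕ[X], ∀ a m, sz a + (inp a).size ≤ m → (out a).size ≤ p.eval m :=
  let ⟨_, p, h⟩ := h.exists_program
  ⟨p, fun a m hm => (h a m hm).1⟩

theorem reindex {β : Type*} (h : PolyTime sz inp out) (φ : β → α) :
    PolyTime (sz ∘ φ) (inp ∘ φ) (out ∘ φ) :=
  let ⟨P, p, h⟩ := h
  ⟨P, p, fun b s hs => h (φ b) s hs⟩

/-- A polynomial of a polynomial is a polynomial. This is how the output size of a subroutine is
replaced by that of the calling algorithm. -/
theorem mono (h : PolyTime sz inp out) {sz' : α → ℕ} (p : ℕ[X])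
    (hp : ∀ a, sz a ≤ p.eval (sz' a + (inp a).size)) : PolyTime sz' inp out := by
  obtain ⟨P, q, h⟩ := h
  refine ⟨P, q.comp (p + X), fun a s hs => (h a s hs).mono ?_ fun _ => _root_.id⟩
  rw [eval_comp]
  refine eval_mono q ?_
  have := hp a
  simp only [eval_add, eval_X]
  omega

theorem congr (h : PolyTime sz inp f) (hfg : ∀ a, f a = g a) : PolyTime sz inp g := by
  rwa [← funext hfg]

theorem id : PolyTime sz inp inp :=
  ⟨.assign 0 (.var 0), X + 1, fun a s hs => .assign (by simp [Term.cost, hs]; omega)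
    (by simp [Term.eval, hs])⟩

theorem nil : PolyTime sz inp fun _ => .nil :=
  ⟨.assign 0 .nil, 2, fun a s _ => .assign (by simp [Term.cost])
    (by simp [Term.eval])⟩

theorem comp (hf : PolyTime sz inp f) (hg : PolyTime sz f g) : PolyTime sz inp g := by
  obtain ⟨P, p, hP⟩ := hf.exists_program
  obtain ⟨Q, q, hQ⟩ := hg.exists_program
  refine ⟨.seq P Q, 1 + p + q.comp (X + p), fun a s hs => ?_⟩
  obtain ⟨h₁, h₂⟩ := hP a _ le_rfl
  refine Runs.mono (T := 1 + p.eval (sz a + (inp a).size) +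
    q.eval (sz a + (inp a).size + p.eval (sz a + (inp a).size)))
    (Runs.seq ((h₂ s hs).mono le_rfl fun s' hs' => ?_)) (by simp) fun _ => _root_.id
  exact ((hQ a _ (by omega)).2 s' hs'.1).mono le_rfl fun _ h => h.1

theorem head (hf : PolyTime sz inp f) : PolyTime sz inp fun a => (f a).head := by
  refine hf.comp ⟨.assign 0 (.head (.var 0)), 2 * X + 1, fun a s hs => .assign ?_
    (by simp [Term.eval, hs])⟩
  have : (f a).head.size ≤ (f a).size := by cases f a <;> simp [Data.head, Data.size]; omega
  simp [Term.cost, Term.eval, hs]; omega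

theorem tail (hf : PolyTime sz inp f) : PolyTime sz inp fun a => (f a).tail := by
  refine hf.comp ⟨.assign 0 (.tail (.var 0)), 2 * X + 1, fun a s hs => .assign ?_
    (by simp [Term.eval, hs])⟩
  have : (f a).tail.size ≤ (f a).size := by cases f a <;> simp [Data.tail, Data.size]; omega
  simp [Term.cost, Term.eval, hs]; omega

theorem cons (hf : PolyTime sz inp f) (hg : PolyTime sz inp g) :
    PolyTime sz inp fun a => .cons (f a) (g a) := by
  obtain ⟨P, p, hP⟩ := hf.exists_program
  obtain ⟨Q, q, hQ⟩ := hg.exists_program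
  obtain ⟨N, hPN, hQN, hN⟩ : ∃ N, P.bound ≤ N ∧ Q.bound ≤ N ∧ 0 < N :=
    ⟨max P.bound Q.bound + 1, by omega, by omega, by omega⟩
  -- Register `N` keeps the input during `P`, and `N + 1` keeps the value of `f` during `Q`.
  refine ⟨.seq (.assign N (.var 0)) <| .seq P <| .seq (.assign (N + 1) (.var 0)) <|
    .seq (.assign 0 (.var N)) <| .seq Q <| .assign 0 (.cons (.var (N + 1)) (.var 0)),
    10 + 2 * X + 4 * p + 4 * q, fun a s hs => ?_⟩
  obtain ⟨hf₁, hf₂⟩ := hP a _ le_rfl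
  obtain ⟨hg₁, hg₂⟩ := hQ a _ le_rfl
  set m := sz a + (inp a).size with hm
  refine Runs.mono (T := 1 + (1 + (inp a).size) + (1 + p.eval m + (1 + (1 + p.eval m) +
      (1 + (1 + (inp a).size) + (1 + q.eval m + (2 * p.eval m + 2 * q.eval m + 2))))))
      (post := fun s' => s' 0 = .cons (f a) (g a)) ?_ (by simp; omega) fun _ => _root_.id
  refine Runs.seq (.assign (by simp [Term.cost, hs]) ?_)
  refine Runs.seq ((hf₂ _ (by simp [Function.update_of_ne hN.ne, hs])).mono le_rfl ?_)
  rintro s₁ ⟨h₁, hfr₁⟩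
  have h₁N : s₁ N = inp a := by rw [hfr₁ N hPN]; simp [Term.eval, hs]
  refine Runs.seq (.assign (by simpa [Term.cost, h₁] using hf₁) ?_)
  refine Runs.seq (.assign (by simp [Term.cost, h₁N]) ?_)
  refine Runs.seq ((hg₂ _ (by simp [Term.eval, h₁N])).mono le_rfl ?_)
  rintro s₂ ⟨h₂, hfr₂⟩
  have h₂N : s₂ (N + 1) = f a := by
    rw [hfr₂ _ (by omega)]; simp [Term.eval, h₁]
  exact .assign (by simp [Term.cost, Term.eval, h₂, h₂N, Data.size]; omega)
    (by simp [Term.eval, h₂, h₂N])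

/-- A case distinction; each branch has to work only for the parameters for which it is taken. -/
theorem cond (hf : PolyTime sz inp f)
    (h₁ : PolyTime (α := {a // f a ≠ .nil}) (fun a => sz a.1) (fun a => inp a.1) fun a => out a.1)
    (h₂ : PolyTime (α := {a // f a = .nil}) (fun a => sz a.1) (fun a => inp a.1) fun a => out a.1) :
    PolyTime sz inp out := by
  obtain ⟨P, p, hP⟩ := hf.exists_program
  obtain ⟨Q, q, hQ⟩ := h₁.exists_program
  obtain ⟨R, r, hR⟩ := h₂.exists_program
  obtain ⟨N, hPN, hN⟩ : ∃ N, P.bound ≤ N ∧ 0 < N :=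
    ⟨P.bound + 1, by omega, by omega⟩
  refine ⟨.seq (.assign N (.var 0)) <| .seq P <| .seq (.assign (N + 1) (.var 0)) <|
    .seq (.assign 0 (.var N)) <| .cond (.var (N + 1)) Q R,
    10 + 2 * X + 4 * p + q + r, fun a s hs => ?_⟩
  obtain ⟨hf₁, hf₂⟩ := hP a _ le_rfl
  set m := sz a + (inp a).size with hm
  refine Runs.mono (T := 1 + (1 + (inp a).size) + (1 + p.eval m + (1 + (1 + p.eval m) +
      (1 + (1 + (inp a).size) + (1 + p.eval m + q.eval m + r.eval m)))))
      (post := fun s' => s' 0 = out a) ?_ (by simp; omega) fun _ => _root_.id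
  refine Runs.seq (.assign (by simp [Term.cost, hs]) ?_)
  refine Runs.seq ((hf₂ _ (by simp [Function.update_of_ne hN.ne, hs])).mono le_rfl ?_)
  rintro s₁ ⟨h₁, hfr₁⟩
  have h₁N : s₁ N = inp a := by rw [hfr₁ N hPN]; simp [Term.eval, hs]
  refine Runs.seq (.assign (by simpa [Term.cost, h₁] using hf₁) ?_)
  refine Runs.seq (.assign (by simp [Term.cost, h₁N]) ?_)
  by_cases h : f a = .nil
  · obtain ⟨t, s₂, hE, ht, hs₂⟩ := (hR ⟨a, h⟩ m le_rfl).2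
      (Function.update (Function.update s₁ (N + 1) (Term.eval s₁ (.var 0))) 0
        (Term.eval (Function.update s₁ (N + 1) (Term.eval s₁ (.var 0))) (.var N)))
      (by simp [Term.eval, h₁N])
    exact ⟨_, s₂, .cond_false (by simp [Term.eval, h₁, h]) hE, by
      simp [Term.cost, Term.eval, h₁]; omega, hs₂.1⟩
  · obtain ⟨t, s₂, hE, ht, hs₂⟩ := (hQ ⟨a, h⟩ m le_rfl).2
      (Function.update (Function.update s₁ (N + 1) (Term.eval s₁ (.var 0))) 0
        (Term.eval (Function.update s₁ (N + 1) (Term.eval s₁ (.var 0))) (.var N)))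
      (by simp [Term.eval, h₁N])
    exact ⟨_, s₂, .cond_true (by simp [Term.eval, h₁, h]) hE, by
      simp [Term.cost, Term.eval, h₁]; omega, hs₂.1⟩

end PolyTime

/-! ### Environments, folds and subroutine calls -/

/-- The input `inp`, extended by one more variable. -/
def extend {α : Type*} {β : α → Type*} (inp : α → Data) (e : ∀ a, β a → Data)
    (x : (a : α) × β a) : Data :=
  .cons (inp x.1) (e x.1 x.2)

/-- The size parameter after the addition of a variable. -/
def extSize {α : Type*} {β : α → Type*} (sz : α → ℕ) (x : (a : α) × β a) : ℕ := sz x.1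

theorem size_le_encList {d : Data} : ∀ {l : List Data}, d ∈ l → d.size ≤ (encList l).size
  | e :: l, h => by
      rcases List.mem_cons.1 h with rfl | h
      · simp [encList, Data.size]; omega
      · have := size_le_encList h
        simp [encList, Data.size]; omega

theorem length_le_encList : ∀ l : List Data, l.length ≤ (encList l).size
  | [] => by simp
  | d :: l => by
      have := length_le_encList l
      simp [encList, Data.size]; omega

theorem encList_size_drop (l : List Data) (k : ℕ) :
    (encList (l.drop k)).size ≤ (encList l).size := by
  induction l generalizing k with
  | nil => simp
  | cons d l ih =>
    cases k with
    | zero => simp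
    | succ k =>
      have := ih k
      simp [encList, Data.size]; omega

theorem encList_size_le {l : List Data} {m : ℕ} (h : ∀ d ∈ l, d.size ≤ m) :
    (encList l).size ≤ l.length * (m + 1) + 1 := by
  induction l with
  | nil => simp [encList, Data.size]
  | cons d l ih =>
    have h₁ := h d (by simp)
    have h₂ := ih fun d hd => h d (by simp [hd])
    simp only [encList, Data.size, List.length_cons]
    rw [Nat.succ_mul]
    omega

namespace PolyTime

variable {α : Type*} {sz : α → ℕ} {inp f g out : α → Data}

/-- Folding a list; the sizes of the intermediate results have to be polynomially bounded. -/
theorem foldl {β σ : α → Type*} {L : ∀ a, List (β a)} {e : ∀ a, β a → Data} {init : ∀ a, σ a}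
    {e' : ∀ a, σ a → Data} {step : ∀ a, σ a → β a → σ a}
    (hL : PolyTime sz inp fun a => encList ((L a).map (e a)))
    (hinit : PolyTime sz inp fun a => e' a (init a))
    (hstep : PolyTime (extSize (extSize sz)) (extend (extend inp e) fun x => e' x.1)
      fun y => e' y.1.1 (step y.1.1 y.2 y.1.2))
    (q : ℕ[X]) (hq : ∀ a l, l <+: L a →
      (e' a (l.foldl (step a) (init a))).size ≤ q.eval (sz a + (inp a).size)) :
    PolyTime sz inp fun a => e' a ((L a).foldl (step a) (init a)) := by
  obtain ⟨P, p, hP⟩ := hL.exists_program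
  obtain ⟨Q, r, hQ⟩ := hinit.exists_program
  obtain ⟨R, u, hR⟩ := hstep.exists_program
  obtain ⟨N, hPN, hQN, hRN, hN⟩ : ∃ N, P.bound ≤ N ∧ Q.bound ≤ N ∧ R.bound ≤ N ∧ 0 < N :=
    ⟨max P.bound (max Q.bound R.bound) + 1, by omega, by omega, by omega, by omega⟩
  -- Bounds one round. The argument of `u` dominates `sz a` plus the size of the twice extended
  -- input: the input, a list entry, the accumulator and two `cons` nodes.
  let T : ℕ[X] := 20 + 4 * X + 10 * p + 10 * q + u.comp (2 * X + p + q + 2)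
  -- Registers: `N` the input, `N + 1` the rest of the list, `N + 2` the accumulator.
  refine ⟨.seq (.assign N (.var 0)) <| .seq P <| .seq (.assign (N + 1) (.var 0)) <|
    .seq (.assign 0 (.var N)) <| .seq Q <| .seq (.assign (N + 2) (.var 0)) <|
    .seq (.loop (.var (N + 1)) <| .seq (.assign 0
      (.cons (.cons (.var N) (.head (.var (N + 1)))) (.var (N + 2)))) <|
      .seq R <| .seq (.assign (N + 2) (.var 0)) (.assign (N + 1) (.tail (.var (N + 1))))) <|
    .assign 0 (.var (N + 2)),
    20 + 4 * X + 4 * p + 4 * q + 4 * r + (p + 1) * (2 * T + 1), fun a s hs => ?_⟩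
  obtain ⟨hf₁, hf₂⟩ := hP a _ le_rfl
  obtain ⟨hg₁, hg₂⟩ := hQ a _ le_rfl
  replace hq := hq a
  set m := sz a + (inp a).size with hm
  have hm' : (inp a).size ≤ m := by omega
  let D : ℕ → List Data := fun k => ((L a).map (e a)).drop k
  let S : ℕ → σ a := fun k => ((L a).take k).foldl (step a) (init a)
  have hD : ∀ k, (encList (D k)).size ≤ p.eval m := fun k =>
    (encList_size_drop _ k).trans hf₁
  have hS : ∀ k, (e' a (S k)).size ≤ q.eval m := fun k => hq _ (List.take_prefix k _)
  let I : ℕ → Store → Prop := fun k s => s N = inp a ∧ s (N + 1) = encList (D k) ∧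
    s (N + 2) = e' a (S k)
  have hloop : ∀ s, I 0 s → Runs (.loop (.var (N + 1)) <| .seq (.assign 0
      (.cons (.cons (.var N) (.head (.var (N + 1)))) (.var (N + 2)))) <|
      .seq R <| .seq (.assign (N + 2) (.var 0)) (.assign (N + 1) (.tail (.var (N + 1))))) s
      (((L a).length + 1) * (2 * T.eval m + 1)) (I (L a).length) := by
    intro s hs
    refine Runs.loop I ?_ ?_ hs
    · rintro k hk s ⟨hs₁, hs₂, hs₃⟩
      have hDk : D k = e a (L a)[k] :: D (k + 1) := by
        simp only [D]
        rw [List.drop_eq_getElem_cons (by simpa using hk)]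
        simp
      have hSk : S (k + 1) = step a (S k) (L a)[k] := by
        simp only [S]
        rw [List.take_succ_eq_append_getElem hk, List.foldl_append, List.foldl_cons, List.foldl_nil]
      have hDs := hD k
      have hDs' := hD (k + 1)
      have hSs := hS k
      have hSs' := hS (k + 1)
      have hel : (e a (L a)[k]).size ≤ p.eval m :=
        (size_le_encList (by simp [hDk])).trans hDs
      have hu : sz a + (Data.cons (.cons (inp a) (e a (L a)[k])) (e' a (S k))).size ≤
          m + m + p.eval m + q.eval m + 2 := by
        simp only [Data.size]; omega
      have hT : T.eval m = 20 + 4 * m + 10 * p.eval m + 10 * q.eval m +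
          u.eval (m + m + p.eval m + q.eval m + 2) := by
        simp [T, eval_comp, two_mul]
      rw [hDk] at hs₂
      refine ⟨by simp [Term.eval, hs₂, encList], ?_, ?_⟩
      · simp only [Term.cost, hs₂, ← hDk]; omega
      · refine Runs.mono (T := 1 + (4 * m + 6 * p.eval m + 6 * q.eval m + 10) +
            (1 + u.eval (m + m + p.eval m + q.eval m + 2) + (1 + (1 + q.eval m) +
            (1 + 2 * p.eval m))))
            (post := I (k + 1)) ?_ (by rw [hT]; omega) fun _ => _root_.id
        refine Runs.seq (.assign ?_ ?_)
        · rw [hDk] at hDs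
          simp [Term.cost, Term.eval, hs₁, hs₂, hs₃, encList, Data.head, Data.size] at hDs ⊢
          omega
        refine Runs.seq (((hR ⟨⟨a, (L a)[k]⟩, S k⟩ _ hu).2 _ ?_).mono le_rfl ?_)
        · simp [Term.eval, hs₁, hs₂, hs₃, encList, Data.head, extend]
        rintro s₁ ⟨h₁, hfr⟩
        have h₁N : s₁ N = inp a := by
          rw [hfr N hRN, Function.update_of_ne (by omega), hs₁]
        have h₁N' : s₁ (N + 1) = encList (e a (L a)[k] :: D (k + 1)) := by
          rw [hfr _ (by omega), Function.update_of_ne (by omega), hs₂]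
        rw [← hSk] at h₁
        refine Runs.seq (.assign ?_ ?_)
        · simpa [Term.cost, h₁] using hSs'
        refine .assign ?_ ?_
        · rw [hDk] at hDs
          simp [Term.cost, Term.eval, h₁N', encList, Data.tail, Data.size] at hDs hDs' ⊢
          omega
        · simp [I, Term.eval, h₁N, h₁N', h₁, encList, Data.tail]
    · rintro s ⟨_, hs₂, _⟩
      have : D (L a).length = [] := by simp [D]
      rw [this] at hs₂
      simp [Term.eval, Term.cost, hs₂, encList, Data.size, T]
      omega
  have hlen : (L a).length ≤ p.eval m := by
    have := length_le_encList ((L a).map (e a))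
    simp at this; omega
  refine Runs.mono (T := 1 + (1 + (inp a).size) + (1 + p.eval m + (1 + (1 + p.eval m) +
      (1 + (1 + (inp a).size) + (1 + r.eval m + (1 + (1 + r.eval m) +
      (1 + ((L a).length + 1) * (2 * T.eval m + 1) + (1 + q.eval m))))))))
      (post := fun s' => s' 0 = e' a ((L a).foldl (step a) (init a))) ?_ ?_ fun _ => _root_.id
  · refine Runs.seq (.assign (by simp [Term.cost, hs]) ?_)
    refine Runs.seq ((hf₂ _ (by simp [Function.update_of_ne hN.ne, hs])).mono le_rfl ?_)
    rintro s₁ ⟨h₁, hfr₁⟩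
    have h₁N : s₁ N = inp a := by rw [hfr₁ N hPN]; simp [Term.eval, hs]
    refine Runs.seq (.assign (by simpa [Term.cost, h₁] using hf₁) ?_)
    refine Runs.seq (.assign (by simp [Term.cost, h₁N]) ?_)
    refine Runs.seq ((hg₂ _ (by simp [Term.eval, h₁N])).mono le_rfl ?_)
    rintro s₂ ⟨h₂, hfr₂⟩
    have h₂N : s₂ N = inp a := by
      rw [hfr₂ _ hQN]; simp [h₁N, hN.ne']
    have h₂N' : s₂ (N + 1) = encList (D 0) := by
      rw [hfr₂ _ (by omega)]; simp [Term.eval, h₁, D]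
    refine Runs.seq (.assign (by simpa [Term.cost, h₂] using hg₁) ?_)
    refine Runs.seq ((hloop _ ⟨by simp [h₂N], by simp [h₂N'], by simp [Term.eval, h₂, S]⟩).mono
      le_rfl ?_)
    rintro s₃ ⟨-, -, h₃⟩
    have hS' := hS (L a).length
    simp only [S, List.take_length] at h₃ hS'
    exact .assign (by simpa [Term.cost, h₃] using hS') (by simp [Term.eval, h₃])
  have := Nat.mul_le_mul_right (2 * T.eval m + 1) (Nat.succ_le_succ hlen)
  simp only [eval_add, eval_mul, eval_ofNat, eval_X, eval_one]
  simp only [Nat.succ_eq_add_one] at this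
  omega

/-- A program that outputs the answers in polynomial time can be called as a subroutine. -/
theorem of_outputs {P : Program} (p : ℕ[X])
    (h : ∀ a, ∃ t, Outputs P (inp a) (out a) t ∧ t ≤ p.eval (sz a + (inp a).size)) :
    PolyTime sz inp out := by
  -- `Outputs` speaks of runs from a store that is `nil` outside variable `0`, so a call must first
  -- erase the variables that `P` mentions.
  have hclear : ∀ n, ∃ Q : Program, ∀ s, Runs Q s (4 * n + 2) fun s' =>
      s' 0 = s 0 ∧ ∀ x, 0 < x → x ≤ n → s' x = .nil := by
    intro n
    induction n with
    -- The language has no empty command; this assignment takes its place.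
    | zero => exact ⟨.assign 1 .nil, fun s => .assign (by simp [Term.cost]) (by simp; omega)⟩
    | succ n ih =>
      obtain ⟨Q, hQ⟩ := ih
      refine ⟨.seq Q (.assign (n + 1) .nil), fun s => ?_⟩
      refine Runs.mono (Runs.seq (T₁ := 4 * n + 2) (T₂ := 2)
        ((hQ s).mono le_rfl fun s' hs' => .assign (by simp [Term.cost]) ?_)) (by omega)
        fun _ => _root_.id
      refine ⟨by simp [hs'.1], fun x hx hxn => ?_⟩
      by_cases hx' : x = n + 1
      · subst hx'; simp [Term.eval]
      · rw [Function.update_of_ne hx']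
        exact hs'.2 x hx (by omega)
  obtain ⟨Q, hQ⟩ := hclear P.bound
  refine ⟨.seq Q P, C (1 + (4 * P.bound + 2)) + p, fun a s hs => ?_⟩
  rw [eval_add, eval_C]
  refine Runs.seq ((hQ s).mono le_rfl fun s₁ hs₁ => ?_)
  obtain ⟨t, ⟨s', hE, hs'⟩, ht⟩ := h a
  -- The `+ 1` ensures that the output variable `0` is among those compared.
  obtain ⟨r, hr, hr'⟩ := hE.congr (N := P.bound + 1) (by omega) s₁ fun x hx => by
    unfold initStore
    split_ifs with h0
    · rw [h0, hs₁.1, hs]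
    · rw [hs₁.2 x (by omega) (by omega)]
  exact ⟨t, r, hr, ht, by simp only; rw [← hr' 0 (by omega), hs']⟩

theorem outputs (h : PolyTime sz inp out) : ∃ (P : Program) (p : ℕ[X]), ∀ a,
    ∃ t, Outputs P (inp a) (out a) t ∧ t ≤ p.eval (sz a + (inp a).size) := by
  obtain ⟨P, p, h⟩ := h
  refine ⟨P, p, fun a => ?_⟩
  obtain ⟨t, s', hE, ht, hs'⟩ := h a (initStore (inp a)) (by simp [initStore])
  exact ⟨t, ⟨s', hE, hs'⟩, ht⟩

end PolyTime
end WhileProg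

/-! ### Polynomial-time operations on lists, numbers and sets -/

namespace WhileProg

open Polynomial

/-! ### Truth values and sizes of encodings -/

open Classical in
/-- The truth value of a proposition. -/
noncomputable def encProp (p : Prop) : Data := encBool (decide p)

theorem encBool_decide (p : Prop) [Decidable p] : encBool (decide p) = encProp p := by
  unfold encProp; congr

theorem encProp_of_true {p : Prop} (h : p) : encProp p = .cons .nil .nil := by
  simp [encProp, encBool, h]

theorem encProp_of_false {p : Prop} (h : ¬ p) : encProp p = .nil := by
  simp [encProp, encBool, h]

@[simp] theorem encProp_eq_nil {p : Prop} : encProp p = .nil ↔ ¬ p := by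
  by_cases h : p <;> simp [h, encProp_of_true, encProp_of_false]

theorem size_encProp_le (p : Prop) : (encProp p).size ≤ 3 := by
  by_cases h : p <;> simp [h, encProp_of_true, encProp_of_false, Data.size]

theorem size_encList (l : List Data) :
    (encList l).size = (l.map fun d => d.size + 1).sum + 1 := by
  induction l with
  | nil => rfl
  | cons d l ih => simp [encList, Data.size, ih]; omega

theorem size_encList_reverse (l : List Data) : (encList l.reverse).size = (encList l).size := by
  simp [size_encList, List.sum_reverse]

theorem size_encList_append (l₁ l₂ : List Data) :
    (encList (l₁ ++ l₂)).size + 1 = (encList l₁).size + (encList l₂).size := by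
  simp [size_encList]; omega

theorem size_encList_sublist {l₁ l₂ : List Data} (h : l₁.Sublist l₂) :
    (encList l₁).size ≤ (encList l₂).size := by
  induction h with
  | slnil => simp
  | cons d _ ih => simp [encList, Data.size]; omega
  | cons_cons d _ ih => simp [encList, Data.size]; omega

theorem size_encNat (n : ℕ) : (encNat n).size = 2 * n + 1 := by
  simp [encNat, size_encList, Data.size]; omega

theorem size_encSet_le {n : ℕ} (A : Finset (Fin n)) : (encSet A).size ≤ 4 * n + 1 := by
  unfold encSet
  refine (encList_size_le (m := 3) fun d hd => ?_).trans ?_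
  · obtain ⟨i, rfl⟩ := (List.mem_ofFn' _ _).1 hd
    simp only [encBool_decide]
    exact size_encProp_le _
  · simp; omega

theorem head_encList_drop {l : List Data} {k : ℕ} (h : k < l.length) :
    (encList (l.drop k)).head = l[k] := by
  rw [List.drop_eq_getElem_cons h]; rfl

theorem encNat_succ (n : ℕ) : encNat (n + 1) = .cons .nil (encNat n) := rfl

/-! ### Logical connectives and list operations -/

namespace PolyTime

variable {α : Type*} {sz : α → ℕ} {inp f g out : α → Data}

/-- Weakening: a further variable may be added to the input. -/
theorem weak {β : α → Type*} {e : ∀ a, β a → Data} (h : PolyTime sz inp f) :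
    PolyTime (extSize sz) (extend inp e)
      fun x => f x.1 :=
  (PolyTime.id.head : PolyTime (extSize sz) (extend inp e) fun x => inp x.1).comp
    (h.reindex Sigma.fst)

/-- The last variable of the input. -/
theorem last {β : α → Type*} {e : ∀ a, β a → Data} :
    PolyTime (extSize sz) (extend inp e)
      fun x => e x.1 x.2 :=
  PolyTime.id.tail

theorem iteProp {p : α → Prop} (hp : PolyTime sz inp fun a => encProp (p a))
    (h₁ : PolyTime (α := {a // p a}) (fun a => sz a.1) (fun a => inp a.1) fun a => out a.1)
    (h₂ : PolyTime (α := {a // ¬ p a}) (fun a => sz a.1) (fun a => inp a.1) fun a => out a.1) :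
    PolyTime sz inp out :=
  hp.cond
    (h₁.reindex fun a : {a // encProp (p a) ≠ .nil} => ⟨a.1, by simpa using a.2⟩)
    (h₂.reindex fun a : {a // encProp (p a) = .nil} => ⟨a.1, by simpa using a.2⟩)

theorem ite {p : α → Prop} [DecidablePred p] (hp : PolyTime sz inp fun a => encProp (p a))
    (hf : PolyTime sz inp f) (hg : PolyTime sz inp g) :
    PolyTime sz inp fun a => if p a then f a else g a :=
  hp.iteProp
    ((hf.reindex Subtype.val).congr fun a => by simp [a.2])
    ((hg.reindex Subtype.val).congr fun a => by simp [a.2])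

theorem true : PolyTime sz inp fun _ => encProp True :=
  (nil.cons nil).congr fun _ => (encProp_of_true trivial).symm

theorem eq_nil (hf : PolyTime sz inp f) : PolyTime sz inp fun a => encProp (f a = .nil) :=
  hf.cond (nil.congr fun a => (encProp_of_false a.2).symm)
    ((nil.cons nil).congr fun a => (encProp_of_true a.2).symm)

theorem not {p : α → Prop} (hp : PolyTime sz inp fun a => encProp (p a)) :
    PolyTime sz inp fun a => encProp (¬ p a) :=
  hp.eq_nil.congr fun a => by simp

theorem and {p q : α → Prop} (hp : PolyTime sz inp fun a => encProp (p a))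
    (hq : PolyTime sz inp fun a => encProp (q a)) :
    PolyTime sz inp fun a => encProp (p a ∧ q a) := by
  classical exact (hp.ite hq nil).congr fun a => by by_cases h : p a <;> simp [h, encProp_of_false]

theorem imp {p q : α → Prop} (hp : PolyTime sz inp fun a => encProp (p a))
    (hq : PolyTime sz inp fun a => encProp (q a)) :
    PolyTime sz inp fun a => encProp (p a → q a) :=
  (hp.and hq.not).not.congr fun a => by simp

theorem or {p q : α → Prop} (hp : PolyTime sz inp fun a => encProp (p a))
    (hq : PolyTime sz inp fun a => encProp (q a)) :
    PolyTime sz inp fun a => encProp (p a ∨ q a) :=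
  (hp.not.imp hq).congr fun a => by rw [or_iff_not_imp_left]

theorem reverse {L : α → List Data} (hL : PolyTime sz inp fun a => encList (L a)) :
    PolyTime sz inp fun a => encList (L a).reverse := by
  have hfold : ∀ l : List Data, l.foldl (fun acc d => d :: acc) [] = l.reverse := by simp
  obtain ⟨p, hp⟩ := hL.size_le
  refine (foldl (β := fun _ => Data) (σ := fun _ => List Data) (L := L) (e := fun _ d => d)
    (init := fun _ => []) (e' := fun _ => encList) (step := fun _ acc d => d :: acc)
    (by simpa using hL) nil (last.weak.cons last) p fun a l hl => ?_).congr
    fun a => by rw [hfold]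
  rw [hfold, size_encList_reverse]
  exact (size_encList_sublist hl.sublist).trans (hp a _ le_rfl)

theorem append {L₁ L₂ : α → List Data} (h₁ : PolyTime sz inp fun a => encList (L₁ a))
    (h₂ : PolyTime sz inp fun a => encList (L₂ a)) :
    PolyTime sz inp fun a => encList (L₁ a ++ L₂ a) := by
  have hfold : ∀ l m : List Data, l.foldl (fun acc d => d :: acc) m = l.reverse ++ m := by simp
  obtain ⟨p, hp⟩ := h₁.size_le
  obtain ⟨q, hq⟩ := h₂.size_le
  refine (foldl (β := fun _ => Data) (σ := fun _ => List Data) (L := fun a => (L₁ a).reverse)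
    (e := fun _ d => d)
    (init := L₂) (e' := fun _ => encList) (step := fun _ acc d => d :: acc)
    (by simpa using h₁.reverse) h₂ (last.weak.cons last) (p + q) fun a l hl => ?_).congr
    fun a => by rw [hfold]; simp
  have h₁ := size_encList_sublist hl.sublist
  have h₂ := size_encList_append l.reverse (L₂ a)
  have := hp a _ le_rfl
  have := hq a _ le_rfl
  rw [size_encList_reverse] at h₁ h₂
  rw [hfold, eval_add]
  omega

variable {β : α → Type*} {e : ∀ a, β a → Data} {L : ∀ a, List (β a)}

/-- Supplies the bound on intermediate results that `foldl` demands: prefixes of `L a` are short,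
and each entry, being part of the encoded list, gives a small value of `G`. -/
theorem size_map_le {G : ∀ a, β a → Data}
    (hL : PolyTime sz inp fun a => encList ((L a).map (e a)))
    (hG : PolyTime (extSize sz) (extend inp e)
      fun x => G x.1 x.2) :
    ∃ p : ℕ[X], ∀ a, ∀ l : List (β a), l.Sublist (L a) → l.length ≤ p.eval (sz a + (inp a).size) ∧
      ∀ b ∈ l, (G a b).size ≤ p.eval (sz a + (inp a).size) := by
  obtain ⟨p, hp⟩ := hL.size_le
  obtain ⟨q, hq⟩ := hG.size_le
  refine ⟨p + q.comp (X + p + 1), fun a l hl => ⟨?_, fun b hb => ?_⟩⟩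
  · have h₁ := hp a _ le_rfl
    have h₂ := length_le_encList ((L a).map (e a))
    have h₃ := hl.length_le
    simp only [List.length_map] at h₂
    simp only [eval_add]; omega
  · have h₁ : (e a b).size ≤ (encList ((L a).map (e a))).size :=
      size_le_encList (List.mem_map_of_mem (hl.subset hb))
    have h₂ := hp a _ le_rfl
    have : (G a b).size ≤ _ := hq ⟨a, b⟩ (sz a + (inp a).size + p.eval (sz a + (inp a).size) + 1)
      (by simp only [extend, extSize, Data.size]; omega)
    simp only [eval_add, eval_comp, eval_X, eval_one]; omega

theorem map {G : ∀ a, β a → Data} (hL : PolyTime sz inp fun a => encList ((L a).map (e a)))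
    (hG : PolyTime (extSize sz) (extend inp e)
      fun x => G x.1 x.2) :
    PolyTime sz inp fun a => encList ((L a).map (G a)) := by
  have hfold : ∀ a, ∀ l : List (β a), l.foldl (fun acc d => G a d :: acc) [] =
      (l.map (G a)).reverse := by
    intro a l
    induction l using List.reverseRecOn with
    | nil => rfl
    | append_singleton l b ih => simp [ih]
  obtain ⟨p, hp⟩ := size_map_le hL hG
  -- The fold pushes to the front, so its result is reversed afterwards.
  refine (foldl (σ := fun _ => List Data) (init := fun _ => []) (e' := fun _ => encList)
    (step := fun a acc d => G a d :: acc) hL nil ((hG.weak).cons last)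
    (p * (p + 1) + 1) fun a l hl => ?_).reverse.congr fun a => by rw [hfold]; simp
  obtain ⟨h₁, h₂⟩ := hp a l hl.sublist
  rw [hfold, size_encList_reverse]
  refine (encList_size_le (m := p.eval (sz a + (inp a).size)) fun d hd => ?_).trans ?_
  · obtain ⟨b, hb, rfl⟩ := List.mem_map.1 hd
    exact h₂ b hb
  · simp only [List.length_map, eval_add, eval_mul, eval_one]
    have := Nat.mul_le_mul_right (p.eval (sz a + (inp a).size) + 1) h₁
    omega

theorem filter {p : ∀ a, β a → Prop} [∀ a, DecidablePred (p a)]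
    (hL : PolyTime sz inp fun a => encList ((L a).map (e a)))
    (hp : PolyTime (extSize sz) (extend inp e)
      fun x => encProp (p x.1 x.2)) :
    PolyTime sz inp fun a => encList (((L a).filter fun b => decide (p a b)).map (e a)) := by
  have hfold : ∀ a, ∀ l : List (β a), l.foldl (fun acc d => if p a d then d :: acc else acc) [] =
      (l.filter fun b => decide (p a b)).reverse := by
    intro a l
    induction l using List.reverseRecOn with
    | nil => rfl
    | append_singleton l b ih => by_cases h : p a b <;> simp [ih, h]
  obtain ⟨q, hq⟩ := hL.size_le
  refine (foldl (σ := fun a => List (β a)) (init := fun _ => [])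
    (e' := fun a l => encList (l.map (e a)))
    (step := fun a acc d => if p a d then d :: acc else acc) hL nil ?_
    q fun a l hl => ?_).reverse.congr fun a => by rw [hfold]; simp
  · refine ((hp.weak).ite ((last.weak).cons last) last).congr fun y => ?_
    split_ifs <;> simp [encList]
  · rw [hfold, List.map_reverse, size_encList_reverse]
    exact (size_encList_sublist ((List.filter_sublist.trans hl.sublist).map _)).trans
      (hq a _ le_rfl)

theorem flatMap {G : ∀ a, β a → List Data}
    (hL : PolyTime sz inp fun a => encList ((L a).map (e a)))
    (hG : PolyTime (extSize sz) (extend inp e)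
      fun x => encList (G x.1 x.2)) :
    PolyTime sz inp fun a => encList ((L a).flatMap (G a)) := by
  have hfold : ∀ a, ∀ l : List (β a), l.foldl (fun acc d => acc ++ G a d) [] =
      l.flatMap (G a) := by
    intro a l
    induction l using List.reverseRecOn with
    | nil => rfl
    | append_singleton l b ih => simp [ih]
  obtain ⟨p, hp⟩ := size_map_le (G := fun a b => encList (G a b)) hL hG
  refine (foldl (σ := fun _ => List Data) (init := fun _ => []) (e' := fun _ => encList)
    (step := fun a acc d => acc ++ G a d) hL nil (last.append (hG.weak))
    (p * p + 1) fun a l hl => ?_).congr fun a => by rw [hfold]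
  obtain ⟨h₁, h₂⟩ := hp a l hl.sublist
  rw [hfold]
  have : (encList (l.flatMap (G a))).size ≤ l.length * p.eval (sz a + (inp a).size) + 1 := by
    clear h₁ hl
    induction l with
    | nil => simp [encList, Data.size]
    | cons b l ih =>
      have h₃ := ih fun b hb => h₂ b (by simp [hb])
      have h₄ := h₂ b (by simp)
      have h₅ := size_encList_append (G a b) (l.flatMap (G a))
      rw [List.flatMap_cons, List.length_cons, Nat.succ_mul]
      omega
  have h₃ := Nat.mul_le_mul_right (p.eval (sz a + (inp a).size)) h₁
  simp only [eval_add, eval_mul, eval_one]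
  omega

/-- A fold whose state is a proposition, encoded in at most three nodes, so the size condition is
automatic. -/
theorem forall_mem {p : ∀ a, β a → Prop}
    (hL : PolyTime sz inp fun a => encList ((L a).map (e a)))
    (hp : PolyTime (extSize sz) (extend inp e)
      fun x => encProp (p x.1 x.2)) :
    PolyTime sz inp fun a => encProp (∀ b ∈ L a, p a b) := by
  have hfold : ∀ a, ∀ l : List (β a), l.foldl (fun acc d => acc ∧ p a d) True =
      ∀ b ∈ l, p a b := by
    intro a l
    induction l using List.reverseRecOn with
    | nil => simp
    | append_singleton l b ih => simp [ih, or_imp, forall_and]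
  exact (foldl (σ := fun _ => Prop) (init := fun _ => True) (e' := fun _ => encProp)
    (step := fun a acc d => acc ∧ p a d) hL true (last.and (hp.weak))
    3 fun a l hl => by simpa using size_encProp_le _).congr fun a => by rw [hfold]

theorem exists_mem {p : ∀ a, β a → Prop}
    (hL : PolyTime sz inp fun a => encList ((L a).map (e a)))
    (hp : PolyTime (extSize sz) (extend inp e)
      fun x => encProp (p x.1 x.2)) :
    PolyTime sz inp fun a => encProp (∃ b ∈ L a, p a b) :=
  (forall_mem (p := fun a b => ¬ p a b) hL hp.not).not.congr fun a => by simp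

/-! ### Unary numbers and characteristic vectors -/

variable {n k : α → ℕ}

theorem drop {L : α → List Data} (hk : PolyTime sz inp fun a => encNat (k a))
    (hL : PolyTime sz inp fun a => encList (L a)) :
    PolyTime sz inp fun a => encList ((L a).drop (k a)) := by
  have hfold : ∀ j, ∀ l : List Data, (List.replicate j Data.nil).foldl
      (fun acc _ => acc.tail) l = l.drop j := by
    intro j
    induction j with
    | zero => simp
    | succ j ih => intro l; rw [List.replicate_succ, List.foldl_cons, ih]; simp
  obtain ⟨q, hq⟩ := hL.size_le
  refine (foldl (β := fun _ => Data) (σ := fun _ => List Data)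
    (L := fun a => List.replicate (k a) .nil) (e := fun _ d => d)
    (init := L) (e' := fun _ => encList) (step := fun _ acc d => acc.tail)
    (by simpa [encNat] using hk) hL ?_ q fun a l hl => ?_).congr
    fun a => by rw [hfold]
  · refine last.tail.congr fun y => ?_
    cases y.2 <;> rfl
  · obtain ⟨-, h⟩ := List.prefix_replicate_iff.1 hl
    rw [h, hfold]
    exact (encList_size_drop _ _).trans (hq a _ le_rfl)

/-- In unary, i ≤ j means that dropping j entries from a list of length i leaves nothing. -/
theorem le {i j : α → ℕ} (hi : PolyTime sz inp fun a => encNat (i a))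
    (hj : PolyTime sz inp fun a => encNat (j a)) :
    PolyTime sz inp fun a => encProp (i a ≤ j a) := by
  refine (hj.drop (L := fun a => List.replicate (i a) .nil) hi).eq_nil.congr fun a => ?_
  congr 1
  rw [List.drop_replicate, ← Nat.sub_eq_zero_iff_le]
  cases i a - j a <;> simp [encList, List.replicate_succ]

theorem fin_eq {i j : ∀ a, Fin (n a)} (hi : PolyTime sz inp fun a => encNat (i a))
    (hj : PolyTime sz inp fun a => encNat (j a)) :
    PolyTime sz inp fun a => encProp (i a = j a) :=
  ((hi.le hj).and (hj.le hi)).congr fun a => by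
    rw [Fin.ext_iff, le_antisymm_iff (a := (i a : ℕ))]

theorem mem {i : ∀ a, Fin (n a)} {A : ∀ a, Finset (Fin (n a))}
    (hi : PolyTime sz inp fun a => encNat (i a)) (hA : PolyTime sz inp fun a => encSet (A a)) :
    PolyTime sz inp fun a => encProp (i a ∈ A a) := by
  refine (hi.drop hA).head.congr fun a => ?_
  rw [head_encList_drop (by simp), List.getElem_ofFn, encBool_decide]

theorem finRange (hn : PolyTime sz inp fun a => encNat (n a)) :
    PolyTime sz inp fun a => encList ((List.finRange (n a)).map fun i : Fin (n a) => encNat i) := by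
  have hfold : ∀ j k : ℕ, (List.replicate j Data.nil).foldl
      (fun acc _ => acc + 1) k = k + j := by
    intro j
    induction j with
    | zero => simp
    | succ j ih => intro l; rw [List.replicate_succ, List.foldl_cons, ih]; omega
  obtain ⟨q, hq⟩ := hn.size_le
  -- The state `k` is written as the unary number `k` together with the reversed list of its
  -- predecessors; pushing the counter before increasing it extends the list.
  refine (foldl (β := fun _ => Data) (σ := fun _ => ℕ)
    (L := fun a => List.replicate (n a) .nil) (e := fun _ d => d)
    (init := fun _ => 0)
    (e' := fun _ k => .cons (encNat k) (encList ((List.range k).map encNat).reverse))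
    (step := fun _ acc d => acc + 1)
    (by simpa [encNat] using hn) (nil.cons nil) ?_
    ((q + 1) * (q + 1) + 2 * q + 2) fun a l hl => ?_).tail.reverse.congr
    fun a => ?_
  · refine ((nil.cons last.head).cons last).congr fun y => ?_
    simp [encNat_succ, Data.head, List.range_succ, encList]
  · obtain ⟨h, h'⟩ := List.prefix_replicate_iff.1 hl
    rw [h', hfold]
    generalize l.length = k at h
    have h₁ := hq a _ le_rfl
    rw [size_encNat] at h₁
    have h₂ : (encList ((List.range (0 + k)).map encNat)).size ≤ k * (2 * k + 1 + 1) + 1 := by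
      refine (encList_size_le (m := 2 * k + 1) fun d hd => ?_).trans (by simp)
      obtain ⟨j, hj, rfl⟩ := List.mem_map.1 hd
      rw [List.mem_range] at hj
      rw [size_encNat]; omega
    have h₃ : k * (2 * k + 1 + 1) ≤
        (q.eval (sz a + (inp a).size) + 1) * (q.eval (sz a + (inp a).size) + 1) :=
      Nat.mul_le_mul (by omega) (by omega)
    simp only [Data.size, size_encNat, size_encList_reverse, eval_add, eval_mul, eval_one,
      eval_ofNat]
    omega
  · rw [hfold]
    simp only [zero_add, List.reverse_reverse]
    rw [← List.map_coe_finRange_eq_range, List.map_map]; rfl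

/-- A set is computable if its membership relation is decidable in polynomial time. -/
theorem set {A : ∀ a, Finset (Fin (n a))} (hn : PolyTime sz inp fun a => encNat (n a))
    (h : PolyTime (extSize sz) (extend inp fun a (i : Fin (n a)) => encNat i)
      fun x => encProp (x.2 ∈ A x.1)) :
    PolyTime sz inp fun a => encSet (A a) := by
  refine (map (G := fun a i => encProp (i ∈ A a)) hn.finRange h).congr fun a => ?_
  simp [encSet, List.ofFn_eq_map, encBool_decide]

theorem forall_fin {p : ∀ a, Fin (n a) → Prop} (hn : PolyTime sz inp fun a => encNat (n a))
    (h : PolyTime (extSize sz) (extend inp fun a (i : Fin (n a)) => encNat i)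
      fun x => encProp (p x.1 x.2)) :
    PolyTime sz inp fun a => encProp (∀ i, p a i) :=
  (forall_mem (p := p) hn.finRange h).congr fun a => by simp

theorem subset {A B : ∀ a, Finset (Fin (n a))} (hn : PolyTime sz inp fun a => encNat (n a))
    (hA : PolyTime sz inp fun a => encSet (A a)) (hB : PolyTime sz inp fun a => encSet (B a)) :
    PolyTime sz inp fun a => encProp (A a ⊆ B a) :=
  forall_fin (p := fun a i => i ∈ A a → i ∈ B a) hn
    ((mem (n := fun x : (a : α) × Fin (n a) => n x.1) last (hA.weak)).imp
      (mem (n := fun x : (a : α) × Fin (n a) => n x.1) last (hB.weak)))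

/-- A subset of `Fin (n a)` has an encoding of size at most `4 * n a + 1`, so iteration cannot make
the data explode. -/
theorem iterate {A : ∀ a, Finset (Fin (n a))} {F : ∀ a, Finset (Fin (n a)) → Finset (Fin (n a))}
    (hn : PolyTime sz inp fun a => encNat (n a)) (hk : PolyTime sz inp fun a => encNat (k a))
    (hA : PolyTime sz inp fun a => encSet (A a))
    (hF : PolyTime (extSize sz) (extend inp fun a (B : Finset (Fin (n a))) => encSet B)
      fun x => encSet (F x.1 x.2)) :
    PolyTime sz inp fun a => encSet ((F a)^[k a] (A a)) := by
  have hfold : ∀ a j A, (List.replicate j Data.nil).foldl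
      (fun acc _ => F a acc) A = (F a)^[j] A := by
    intro a j
    induction j with
    | zero => simp
    | succ j ih => intro A; rw [List.replicate_succ, List.foldl_cons, ih]; rfl
  obtain ⟨q, hq⟩ := hn.size_le
  refine (foldl (β := fun _ => Data) (σ := fun a => Finset (Fin (n a)))
    (L := fun a => List.replicate (k a) .nil) (e := fun _ d => d)
    (init := A) (e' := fun _ => encSet) (step := fun a acc _ => F a acc)
    (by simpa [encNat] using hk) hA ?_ (4 * q + 1) fun a l hl => ?_).congr
    fun a => by rw [hfold]
  -- The environment of the fold also contains a dummy list entry, which is removed before `hF`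
  -- applies.
  · exact ((PolyTime.id.weak.weak : PolyTime _ _
      fun y : (x : (_ : α) × Data) × Finset (Fin (n x.1)) => inp y.1.1).cons last).comp
      (hF.reindex fun y : (x : (_ : α) × Data) × Finset (Fin (n x.1)) => ⟨y.1.1, y.2⟩)
  · have h₁ := hq a _ le_rfl
    rw [size_encNat] at h₁
    refine (size_encSet_le _).trans ?_
    simp only [eval_add, eval_mul, eval_ofNat, eval_one]
    omega

end PolyTime

/-- Once a list is chosen for every instance, its encoded size can play the role of `sz`. Reductions
then need only the combinators, and never programs. -/
theorem EnumProblem.outputPolynomial_iff {Q : EnumProblem} :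
    Q.OutputPolynomial ↔ ∃ L : ∀ i, List (Q.Item i),
      (∀ i, (L i).Nodup ∧ Q.IsAnswer i {y | y ∈ L i}) ∧
      PolyTime (fun i => (encList ((L i).map (Q.encItem i))).size) Q.encInst
        fun i => encList ((L i).map (Q.encItem i)) := by
  constructor
  · rintro ⟨P, p, h⟩
    choose L t h₁ h₂ h₃ h₄ using h
    exact ⟨L, fun i => ⟨h₁ i, h₂ i⟩, .of_outputs p fun i =>
      ⟨t i, h₃ i, by rw [add_comm]; exact h₄ i⟩⟩
  · rintro ⟨L, h, hL⟩
    obtain ⟨P, p, hP⟩ := hL.outputs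
    refine ⟨P, p, fun i => ?_⟩
    obtain ⟨t, h₁, h₂⟩ := hP i
    exact ⟨L i, t, (h i).1, (h i).2, h₁, by rwa [add_comm]⟩

end WhileProg

/-! ### Closure systems, `D`-generators and dual antichains -/

namespace ClosureSys

section General

variable {U : Type} [Fintype U] [DecidableEq U] {C : Finset (Finset U)}

/-! ### The closure operator and standardness -/

theorem mem_cl {A : Finset U} {x : U} : x ∈ cl C A ↔ ∀ F ∈ C, A ⊆ F → x ∈ F := by
  rw [← Finset.singleton_subset_iff, cl, Finset.le_inf_iff]
  simp

theorem subset_cl (A : Finset U) : A ⊆ cl C A := fun _ hx => mem_cl.2 fun _ _ h => h hx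

theorem cl_subset {A F : Finset U} (hF : F ∈ C) (h : A ⊆ F) : cl C A ⊆ F :=
  fun _ hx => mem_cl.1 hx F hF h

theorem cl_mono {A B : Finset U} (h : A ⊆ B) : cl C A ⊆ cl C B :=
  fun _ hx => mem_cl.2 fun F hF hB => mem_cl.1 hx F hF (h.trans hB)

theorem cl_eq_self {F : Finset U} (hF : F ∈ C) : cl C F = F :=
  (cl_subset hF subset_rfl).antisymm (subset_cl F)

theorem IsClosureSystem.inf_mem (hC : IsClosureSystem C) {S : Finset (Finset U)} (hS : S ⊆ C) :
    S.inf id ∈ C := by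
  induction S using Finset.induction_on with
  | empty => simpa using hC.1
  | insert F S _ ih =>
    rw [Finset.inf_insert]
    exact hC.2 _ (hS (by simp)) _ (ih ((Finset.subset_insert _ _).trans hS))

theorem IsClosureSystem.cl_mem (hC : IsClosureSystem C) (A : Finset U) : cl C A ∈ C :=
  hC.inf_mem (Finset.filter_subset _ _)

theorem mem_cl_self (a : U) : a ∈ cl C {a} := subset_cl _ (by simp)

theorem IsClosureSystem.cl_singleton_subset (hC : IsClosureSystem C) {A : Finset U} {a : U}
    (h : a ∈ cl C A) : cl C {a} ⊆ cl C A :=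
  cl_subset (hC.cl_mem A) (by simpa using h)

/-- If a ≠ b, then cl(b) \ {b} is a closed set containing a, so cl(a) misses b. -/
theorem IsStandard.antisymm (hs : IsStandard C) {a b : U}
    (hab : a ∈ cl C {b}) (hba : b ∈ cl C {a}) : a = b := by
  by_contra hne
  have h : cl C {a} ⊆ cl C {b} \ {b} := cl_subset (hs b) (by simp [hab, hne])
  simpa using h hba

/-- Each a is avoided by the closed set cl(a) \ {a}. -/
theorem IsStandard.cl_empty (hs : IsStandard C) : cl C ∅ = ∅ := by
  rw [Finset.eq_empty_iff_forall_notMem]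
  intro a ha
  have := cl_subset (hs a) (Finset.empty_subset _) ha
  simp at this

/-! ### Order ideals and `D`-generators -/

/-- `F` is an ideal of the order in which `b` is below `a` if `b` is in the closure of `a`. -/
def IsDown (C : Finset (Finset U)) (F : Finset U) : Prop := ∀ a ∈ F, cl C {a} ⊆ F

theorem isDown_of_mem {F : Finset U} (hF : F ∈ C) : IsDown C F :=
  fun _ ha => cl_subset hF (by simpa using ha)

theorem mem_clb {A : Finset U} {x : U} : x ∈ clb C A ↔ ∃ a ∈ A, x ∈ cl C {a} := by
  simp [clb]

theorem subset_clb (A : Finset U) : A ⊆ clb C A :=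
  fun a ha => mem_clb.2 ⟨a, ha, mem_cl_self a⟩

theorem IsClosureSystem.isDown_clb (hC : IsClosureSystem C) (A : Finset U) :
    IsDown C (clb C A) := by
  intro a ha x hx
  obtain ⟨b, hb, hab⟩ := mem_clb.1 ha
  exact mem_clb.2 ⟨b, hb, hC.cl_singleton_subset hab hx⟩

theorem IsDown.clb_subset {A F : Finset U} (hF : IsDown C F) (h : A ⊆ F) : clb C A ⊆ F := by
  intro x hx
  obtain ⟨a, ha, hax⟩ := mem_clb.1 hx
  exact hF a (h ha) hax

theorem IsClosureSystem.cl_clb (hC : IsClosureSystem C) (A : Finset U) :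
    cl C (clb C A) = cl C A :=
  (cl_subset (hC.cl_mem A) ((isDown_of_mem (hC.cl_mem A)).clb_subset (subset_cl A))).antisymm
    (cl_mono (subset_clb A))

/-- The maximal elements of `F` in the order in which `b` is below `a` if `b` is in the closure
of `a`. -/
def maxElts (C : Finset (Finset U)) (F : Finset U) : Finset U :=
  F.filter fun a => ∀ b ∈ F, a ∈ cl C {b} → a = b

theorem maxElts_subset (F : Finset U) : maxElts C F ⊆ F := Finset.filter_subset _ _

/-- A finite ideal is generated by its maximal elements. Above a given a, one with the largest
closure is maximal, because by standardness distinct elements have distinct closures. -/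
theorem IsClosureSystem.clb_maxElts (hC : IsClosureSystem C) (hs : IsStandard C) {F : Finset U}
    (hF : IsDown C F) : clb C (maxElts C F) = F := by
  refine (hF.clb_subset (maxElts_subset F)).antisymm fun a ha => ?_
  obtain ⟨b, hb, hmax⟩ := (F.filter fun b => a ∈ cl C {b}).exists_max_image
    (fun b => (cl C {b}).card) ⟨a, by simp [ha, mem_cl_self]⟩
  rw [Finset.mem_filter] at hb
  refine mem_clb.2 ⟨b, Finset.mem_filter.2 ⟨hb.1, fun d hd hbd => ?_⟩, hb.2⟩
  have hsub := hC.cl_singleton_subset hbd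
  have := Finset.eq_of_subset_of_card_le hsub
    (hmax d (Finset.mem_filter.2 ⟨hd, hsub hb.2⟩))
  exact hs.antisymm hbd (this ▸ mem_cl_self d)

theorem exists_isMinGen {A : Finset U} {c : U} (h : c ∈ cl C A) :
    ∃ A' ⊆ A, IsMinGen C A' c := by
  induction A using Finset.strongInduction with
  | H A ih =>
    by_cases hA : ∃ A', A' ⊂ A ∧ c ∈ cl C A'
    · obtain ⟨A', hA', hc⟩ := hA
      obtain ⟨A'', h₁, h₂⟩ := ih A' hA' hc
      exact ⟨A'', h₁.trans hA'.subset, h₂⟩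
    · exact ⟨A, subset_rfl, h, fun A' hA' hc => hA ⟨A', hA', hc⟩⟩

/-- `F` is a minimal order ideal whose closure contains `c`. -/
def IsMinDown (C : Finset (Finset U)) (c : U) (F : Finset U) : Prop :=
  IsDown C F ∧ c ∈ cl C F ∧ ∀ F' ⊆ F, IsDown C F' → c ∈ cl C F' → F' = F

/-- If A ⊆ F generates c, then so does the ideal cl^b(A) ⊆ F, which equals F by minimality; hence A
contains every maximal element of F. So the maximal elements are the least generator of c inside F.
-/
theorem IsMinDown.isDGen_maxElts (hC : IsClosureSystem C) (hs : IsStandard C) {c : U}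
    {F : Finset U} (hF : IsMinDown C c F) (hc : c ∉ F) : IsDGen C (maxElts C F) c := by
  have hmax := hC.clb_maxElts hs hF.1
  have key : ∀ A ⊆ F, c ∈ cl C A → maxElts C F ⊆ A := by
    intro A hA hcA a ha
    have h₁ := hF.2.2 (clb C A) (hF.1.clb_subset hA) (hC.isDown_clb A) (by rwa [hC.cl_clb])
    have haF := maxElts_subset F ha
    rw [← h₁] at haF
    obtain ⟨b, hb, hab⟩ := mem_clb.1 haF
    rw [(Finset.mem_filter.1 ha).2 b (hA hb) hab]
    exact hb
  refine ⟨⟨by rw [← hC.cl_clb, hmax]; exact hF.2.1, fun A hA hcA => ?_⟩, by rwa [hmax],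
    fun A hA hAF => ?_⟩
  · exact hA.2 (key A (hA.subset.trans (maxElts_subset F)) hcA)
  · rw [hmax] at hAF
    by_contra hne
    refine hA.2 (maxElts C F) (Finset.ssubset_iff_subset_ne.2
      ⟨key A hAF hA.1, fun h => hne h.symm⟩) ?_
    rw [← hC.cl_clb, hmax]; exact hF.2.1

/-- An ideal F ⊆ cl^b(A) that generates c contains a minimal generator of c. That generator must be
A, so F contains cl^b(A). -/
theorem IsDGen.isMinDown_clb (hC : IsClosureSystem C) {c : U} {A : Finset U}
    (hA : IsDGen C A c) : IsMinDown C c (clb C A) := by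
  refine ⟨hC.isDown_clb A, by rw [hC.cl_clb]; exact hA.1.1, fun F hF hFd hc => ?_⟩
  obtain ⟨A', hA'F, hA'⟩ := exists_isMinGen hc
  obtain rfl := hA.2.2 A' hA' (hA'F.trans hF)
  exact hF.antisymm (hFd.clb_subset hA'F)

theorem IsDGen.maxElts_clb (hC : IsClosureSystem C) (hs : IsStandard C) {c : U} {A : Finset U}
    (hA : IsDGen C A c) : maxElts C (clb C A) = A :=
  hA.2.2 _ ((hA.isMinDown_clb hC).isDGen_maxElts hC hs hA.2.1).1 (maxElts_subset _)

theorem not_isDGen_singleton {a c : U} (h : c ∈ cl C {a}) : ¬ IsDGen C {a} c :=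
  fun hA => hA.2.1 (mem_clb.2 ⟨a, by simp, h⟩)

/-- cl(c) is an ideal inside F that already generates c. So at most one minimal ideal fails to give
a `D`-generator. -/
theorem IsMinDown.eq_cl_singleton {c : U} (hC : IsClosureSystem C) {F : Finset U}
    (hF : IsMinDown C c F) (hc : c ∈ F) : F = cl C {c} :=
  (hF.2.2 (cl C {c}) (hF.1 c hc) (isDown_of_mem (hC.cl_mem _))
    (subset_cl _ (mem_cl_self c))).symm

/-! ### Meet-irreducible elements -/

theorem mem_meetIrreducibles {M : Finset U} : M ∈ meetIrreducibles C ↔ M ∈ C ∧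
    M ≠ Finset.univ ∧ ∀ F₁ ∈ C, ∀ F₂ ∈ C, F₁ ∩ F₂ = M → F₁ = M ∨ F₂ = M := by
  simp [meetIrreducibles]

/-- A closed set is meet-irreducible if it is maximal among those that avoid an element. -/
theorem mem_meetIrreducibles_of_maximal {M : Finset U} {x : U} (hM : M ∈ C) (hx : x ∉ M)
    (hmax : ∀ G ∈ C, M ⊆ G → x ∉ G → G = M) : M ∈ meetIrreducibles C := by
  refine mem_meetIrreducibles.2 ⟨hM, fun h => hx (by simp [h]), fun F₁ h₁ F₂ h₂ h => ?_⟩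
  by_cases hx₁ : x ∈ F₁
  · refine Or.inr (hmax F₂ h₂ (by simp [← h]) fun hx₂ => hx ?_)
    rw [← h]; exact Finset.mem_inter.2 ⟨hx₁, hx₂⟩
  · exact Or.inl (hmax F₁ h₁ (by simp [← h]) hx₁)

theorem exists_maximal_avoiding {V : Type} [DecidableEq V] {C : Finset (Finset V)}
    {F : Finset V} {x : V} (hF : F ∈ C) (hx : x ∉ F) :
    ∃ M ∈ C, F ⊆ M ∧ x ∉ M ∧ ∀ G ∈ C, M ⊆ G → x ∉ G → G = M := by
  obtain ⟨M, hFM, hM⟩ := (C.filter fun G => x ∉ G).exists_le_maximal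
    (Finset.mem_filter.2 ⟨hF, hx⟩)
  have hM' := Finset.mem_filter.1 hM.prop
  exact ⟨M, hM'.1, hFM, hM'.2, fun G hG hMG hxG =>
    (hM.eq_of_le (Finset.mem_filter.2 ⟨hG, hxG⟩) hMG).symm⟩

/-- A closed set avoiding x extends to a maximal one, which is meet-irreducible. Thus closures can
be computed from the meet-irreducibles alone. -/
theorem IsClosureSystem.mem_cl_iff_meetIrreducibles (hC : IsClosureSystem C) {A : Finset U}
    {x : U} : x ∈ cl C A ↔ ∀ M ∈ meetIrreducibles C, A ⊆ M → x ∈ M := by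
  refine ⟨fun h M hM => mem_cl.1 h M (mem_meetIrreducibles.1 hM).1, fun h => ?_⟩
  by_contra hx
  obtain ⟨M, hM, hAM, hxM, hmax⟩ := exists_maximal_avoiding (hC.cl_mem A) hx
  exact hxM (h M (mem_meetIrreducibles_of_maximal hM hxM hmax) ((subset_cl A).trans hAM))

/-- A family whose intersections are all closed sets contains the meet-irreducible ones. -/
theorem IsClosureSystem.mem_of_mem_meetIrreducibles (hC : IsClosureSystem C)
    {S : Finset (Finset U)} (hS : S ⊆ C)
    (h : ∀ F ∈ C, ∀ x ∉ F, ∃ M ∈ S, F ⊆ M ∧ x ∉ M) {M : Finset U}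
    (hM : M ∈ meetIrreducibles C) : M ∈ S := by
  obtain ⟨hMC, hne, hirr⟩ := mem_meetIrreducibles.1 hM
  -- Irreducibility passes from two sets to any finite family; the empty intersection is the
  -- excluded ground set.
  have key : ∀ T : Finset (Finset U), T ⊆ C → T.inf id = M → M ∈ T := by
    intro T hT
    induction T using Finset.induction_on with
    | empty => intro h; exact absurd h.symm (by simpa using hne)
    | insert F T _ ih =>
      intro hinf
      rw [Finset.inf_insert] at hinf
      have hT' := (Finset.subset_insert F T).trans hT
      rcases hirr F (hT (by simp)) (T.inf id) (hC.inf_mem hT') hinf with h | h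
      · simp [← h]
      · exact Finset.mem_insert_of_mem (ih hT' h)
  refine (Finset.mem_filter.1 (key (S.filter fun G => M ⊆ G)
    ((Finset.filter_subset _ _).trans hS) ?_)).1
  refine Finset.Subset.antisymm (fun x hx => ?_) ?_
  · by_contra hxM
    obtain ⟨G, hG, hMG, hxG⟩ := h M hMC x hxM
    have : (S.filter fun G => M ⊆ G).inf id ≤ G := Finset.inf_le (f := id) (by simp [hG, hMG])
    exact hxG (this hx)
  · exact Finset.le_inf fun G hG => (Finset.mem_filter.1 hG).2

/-! ### Dual antichains and implicational bases -/

/-- The member of a dual pair is the set of minimal elements outside the order ideal. -/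
theorem areDual_iff {Bm Bp : Set (Finset U)} (hBp : IsAntichainOf C Bp) :
    AreDual C Bm Bp ↔ ∀ F, F ∈ Bm ↔ F ∈ C ∧ (∀ G ∈ Bp, ¬ F ⊆ G) ∧
      ∀ F' ∈ C, F' ⊆ F → (∀ G ∈ Bp, ¬ F' ⊆ G) → F' = F := by
  constructor
  · rintro ⟨⟨hBmC, hBm⟩, -, hunion, hinter⟩ F
    have hnot : ∀ G, G ∈ C → (∃ H ∈ Bm, H ⊆ G) → ∀ K ∈ Bp, ¬ G ⊆ K := by
      rintro G hG hH K hK hGK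
      have : G ∈ orderFilter C Bm ∩ ideal C Bp := ⟨⟨hG, hH⟩, hG, K, hK, hGK⟩
      rw [hinter] at this
      exact this
    have hex : ∀ G ∈ C, (∀ K ∈ Bp, ¬ G ⊆ K) → ∃ H ∈ Bm, H ⊆ G := by
      intro G hG hK
      have : G ∈ orderFilter C Bm ∪ ideal C Bp := by rw [hunion]; exact hG
      rcases this with h | ⟨-, K, hKB, hGK⟩
      · exact h.2
      · exact absurd hGK (hK K hKB)
    constructor
    · intro hF
      refine ⟨hBmC F hF, hnot F (hBmC F hF) ⟨F, hF, subset_rfl⟩, fun F' hF' hsub h => ?_⟩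
      obtain ⟨H, hH, hHF'⟩ := hex F' hF' h
      have := hBm.eq hH hF (hHF'.trans hsub)
      subst this
      exact hsub.antisymm hHF'
    · rintro ⟨hF, hFp, hmin⟩
      obtain ⟨H, hH, hHF⟩ := hex F hF hFp
      rwa [← hmin H (hBmC H hH) hHF (hnot H (hBmC H hH) ⟨H, hH, subset_rfl⟩)]
  · intro h
    refine ⟨⟨fun F hF => ((h F).1 hF).1, fun F hF G hG hne hFG => hne ?_⟩, hBp, ?_, ?_⟩
    · obtain ⟨h₁, h₂, -⟩ := (h F).1 hF
      exact ((h G).1 hG).2.2 F h₁ hFG h₂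
    · ext F
      refine ⟨fun hF => hF.elim (fun h => h.1) fun h => h.1, fun hF => ?_⟩
      have hF : F ∈ C := hF
      by_cases hFp : ∃ G ∈ Bp, F ⊆ G
      · exact Or.inr ⟨hF, hFp⟩
      · push Not at hFp
        classical
        obtain ⟨H, hHF, hH⟩ := (C.filter fun G => ∀ K ∈ Bp, ¬ G ⊆ K).exists_le_minimal
          (Finset.mem_filter.2 ⟨hF, hFp⟩)
        have hH' := Finset.mem_filter.1 hH.prop
        refine Or.inl ⟨hF, H, (h H).2 ⟨hH'.1, hH'.2, fun F' hF' hsub hFp' => ?_⟩, hHF⟩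
        exact hH.eq_of_le (Finset.mem_filter.2 ⟨hF', hFp'⟩) hsub
    · rw [Set.eq_empty_iff_forall_notMem]
      rintro F ⟨⟨-, H, hH, hHF⟩, -, K, hK, hFK⟩
      exact ((h H).1 hH).2.1 K hK (hHF.trans hFK)

theorem isClosureSystem_closedSets (S : List (Implication U)) :
    IsClosureSystem (closedSets S) := by
  refine ⟨by simp [closedSets], fun F₁ h₁ F₂ h₂ => ?_⟩
  simp only [closedSets, Finset.mem_filter, Finset.mem_univ, true_and] at *
  intro i hi hsub
  rw [Finset.subset_inter_iff] at hsub
  exact Finset.mem_inter.2 ⟨h₁ i hi hsub.1, h₂ i hi hsub.2⟩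

theorem mem_closedSets {S : List (Implication U)} {F : Finset U} :
    F ∈ closedSets S ↔ ∀ i ∈ S, i.1 ⊆ F → i.2 ∈ F := by
  simp [closedSets]

end General

end ClosureSys

/-! ### From dualization to the `D`-base -/

namespace ClosureSys

section Binary

variable {n : ℕ} {C : Finset (Finset (Fin n))}

/-! ### The lattice of order ideals and its binary base -/

open Classical in
/-- The binary implications of the `D`-base. -/
noncomputable def binaryBase (C : Finset (Finset (Fin n))) : List (Implication (Fin n)) :=
  (List.finRange n).flatMap fun a =>
    ((List.finRange n).filter fun b => decide (b ∈ cl C {a} ∧ ¬ b = a)).map fun b => ({a}, b)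

theorem mem_binaryBase {i : Implication (Fin n)} :
    i ∈ binaryBase C ↔ ∃ a c, c ∈ cl C {a} \ {a} ∧ i = ({a}, c) := by
  simp only [binaryBase, List.mem_flatMap, List.mem_finRange, true_and, List.mem_map,
    List.mem_filter, decide_eq_true_eq, Finset.mem_sdiff, Finset.mem_singleton, @eq_comm _ i]

theorem nodup_binaryBase : (binaryBase C).Nodup := by
  refine List.nodup_flatMap.2 ⟨fun a _ => ?_, ?_⟩
  · exact ((List.nodup_finRange n).filter _).map fun b c h => (Prod.ext_iff.1 h).2
  · refine (List.nodup_finRange n).imp fun {a b} hab => ?_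
    rw [Function.onFun, List.disjoint_left]
    rintro i hi hi'
    obtain ⟨c, -, rfl⟩ := List.mem_map.1 hi
    obtain ⟨d, -, h⟩ := List.mem_map.1 hi'
    exact hab (Finset.singleton_injective (Prod.ext_iff.1 h).1).symm

theorem mem_closedSets_binaryBase {F : Finset (Fin n)} :
    F ∈ closedSets (binaryBase C) ↔ IsDown C F := by
  rw [mem_closedSets]
  constructor
  · intro h a ha c hc
    by_cases hca : c = a
    · rwa [hca]
    · exact h ({a}, c) (mem_binaryBase.2 ⟨a, c, by simp [hc, hca], rfl⟩) (by simpa using ha)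
  · rintro h i hi hsub
    obtain ⟨a, c, hc, rfl⟩ := mem_binaryBase.1 hi
    exact h a (by simpa using hsub) (Finset.mem_sdiff.1 hc).1

/-- Closed sets are ideals and every ideal containing a contains cl(a), so principal closures, and
with them standardness, pass to the lattice of ideals. -/
theorem IsClosureSystem.cl_binaryBase (hC : IsClosureSystem C) (a : Fin n) :
    cl (closedSets (binaryBase C)) {a} = cl C {a} := by
  refine (cl_subset ?_ (by simpa using mem_cl_self a)).antisymm fun x hx => mem_cl.2 ?_
  · exact mem_closedSets_binaryBase.2 (isDown_of_mem (hC.cl_mem _))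
  · intro F hF ha
    exact mem_closedSets_binaryBase.1 hF a (by simpa using ha) hx

theorem IsClosureSystem.isStandard_binaryBase (hC : IsClosureSystem C) (hs : IsStandard C) :
    IsStandard (closedSets (binaryBase C)) := by
  intro a
  rw [hC.cl_binaryBase, mem_closedSets_binaryBase]
  exact isDown_of_mem (hs a)

theorem isDistributive_binaryBase : IsDistributive (closedSets (binaryBase C)) := by
  intro F hF G hG
  rw [mem_closedSets_binaryBase] at *
  intro a ha
  rcases Finset.mem_union.1 ha with h | h
  · exact (hF a h).trans Finset.subset_union_left
  · exact (hG a h).trans Finset.subset_union_right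

/-! ### Maximal closed sets avoiding an element -/

open Classical in
/-- The sets in a list that are maximal among those that avoid `c`. -/
noncomputable def maximalAvoiding (S : List (Finset (Fin n))) (c : Fin n) :
    List (Finset (Fin n)) :=
  S.filter fun M => decide (¬ c ∈ M ∧ ∀ M' ∈ S, ¬ c ∈ M' → M ⊆ M' → M' ⊆ M)

/-- Comparison within the list is enough: any closed set avoiding c extends to a maximal such set,
which is meet-irreducible and so is listed. -/
theorem mem_maximalAvoiding {S : List (Finset (Fin n))}
    (hS : ∀ M, M ∈ S ↔ M ∈ meetIrreducibles C) {c : Fin n} {M : Finset (Fin n)} :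
    M ∈ maximalAvoiding S c ↔ M ∈ C ∧ c ∉ M ∧ ∀ G ∈ C, M ⊆ G → c ∉ G → G = M := by
  simp only [maximalAvoiding, List.mem_filter, decide_eq_true_eq]
  constructor
  · rintro ⟨hM, hc, hmax⟩
    refine ⟨(mem_meetIrreducibles.1 ((hS M).1 hM)).1, hc, fun G hG hMG hcG => ?_⟩
    obtain ⟨N, hN, hGN, hcN, hmaxN⟩ := exists_maximal_avoiding hG hcG
    have := hmax N ((hS N).2 (mem_meetIrreducibles_of_maximal hN hcN hmaxN)) hcN
      (hMG.trans hGN)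
    exact (hGN.trans this).antisymm hMG
  · rintro ⟨hM, hc, hmax⟩
    refine ⟨(hS M).2 (mem_meetIrreducibles_of_maximal hM hc hmax), hc, fun N hN hcN hMN => ?_⟩
    rw [hmax N (mem_meetIrreducibles.1 ((hS N).1 hN)).1 hMN hcN]

theorem isAntichainOf_maximalAvoiding {S : List (Finset (Fin n))}
    (hS : ∀ M, M ∈ S ↔ M ∈ meetIrreducibles C) (c : Fin n) :
    IsAntichainOf (closedSets (binaryBase C)) {M | M ∈ maximalAvoiding S c} := by
  refine ⟨fun M hM => mem_closedSets_binaryBase.2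
    (isDown_of_mem ((mem_maximalAvoiding hS).1 hM).1), fun M hM N hN hne hMN => hne ?_⟩
  have hM := (mem_maximalAvoiding hS).1 hM
  have hN := (mem_maximalAvoiding hS).1 hN
  exact (hM.2.2 N hN.1 hMN hN.2.1).symm

/-- The ideals whose closure contains `c` are those below no maximal closed set avoiding `c`. -/
theorem IsClosureSystem.mem_cl_iff_maximalAvoiding (hC : IsClosureSystem C)
    {S : List (Finset (Fin n))} (hS : ∀ M, M ∈ S ↔ M ∈ meetIrreducibles C) {c : Fin n}
    {F : Finset (Fin n)} : c ∈ cl C F ↔ ∀ M ∈ maximalAvoiding S c, ¬ F ⊆ M := by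
  constructor
  · intro h M hM hFM
    have hM := (mem_maximalAvoiding hS).1 hM
    exact hM.2.1 (cl_subset hM.1 hFM h)
  · intro h
    by_contra hc
    obtain ⟨M, hM, hFM, hcM, hmax⟩ := exists_maximal_avoiding (hC.cl_mem F) hc
    exact h M ((mem_maximalAvoiding hS).2 ⟨hM, hcM, hmax⟩) ((subset_cl F).trans hFM)

theorem IsClosureSystem.areDual_maximalAvoiding_iff (hC : IsClosureSystem C)
    {S : List (Finset (Fin n))} (hS : ∀ M, M ∈ S ↔ M ∈ meetIrreducibles C) {c : Fin n}
    {B : Set (Finset (Fin n))} :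
    AreDual (closedSets (binaryBase C)) B {M | M ∈ maximalAvoiding S c} ↔
      ∀ F, F ∈ B ↔ IsMinDown C c F := by
  rw [areDual_iff (isAntichainOf_maximalAvoiding hS c)]
  refine forall_congr' fun F => ?_
  simp only [Set.mem_ofPred_eq, ← hC.mem_cl_iff_maximalAvoiding hS, mem_closedSets_binaryBase,
    IsMinDown]
  grind

/-! ### The `D`-base assembled from minimal ideals -/

open Classical in
/-- The `D`-base, from the minimal ideals whose closures contain the elements of the ground set. -/
noncomputable def dBaseList (C : Finset (Finset (Fin n))) (B : Fin n → List (Finset (Fin n))) :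
    List (Implication (Fin n)) :=
  binaryBase C ++ (List.finRange n).flatMap fun c =>
    ((B c).filter fun F => decide (¬ c ∈ F)).map fun F => (maxElts C F, c)

variable {B : Fin n → List (Finset (Fin n))}

theorem IsClosureSystem.mem_dBaseList_iff (hC : IsClosureSystem C) (hs : IsStandard C)
    (hB : ∀ c F, F ∈ B c ↔ IsMinDown C c F) {i : Implication (Fin n)} :
    i ∈ dBaseList C B ↔ i ∈ dBase C := by
  simp only [dBaseList, dBase, List.mem_append, mem_binaryBase, Set.mem_union, Set.mem_ofPred_eq]
  refine or_congr_right ?_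
  simp only [List.mem_flatMap, List.mem_map, List.mem_filter, decide_eq_true_eq, hB]
  constructor
  · rintro ⟨c, -, F, ⟨hF, hc⟩, rfl⟩
    exact ⟨_, c, hF.isDGen_maxElts hC hs hc, rfl⟩
  · rintro ⟨A, c, hA, rfl⟩
    exact ⟨c, by simp, clb C A, ⟨hA.isMinDown_clb hC, hA.2.1⟩, by rw [hA.maxElts_clb hC hs]⟩

/-- An ideal is recovered from its maximal elements, so no `D`-generator repeats; and a binary
premise {a} has c ∈ cl^b({a}), so it is not a `D`-generator of c. -/
theorem IsClosureSystem.nodup_dBaseList (hC : IsClosureSystem C) (hs : IsStandard C)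
    (hB : ∀ c F, F ∈ B c ↔ IsMinDown C c F) (hnd : ∀ c, (B c).Nodup) :
    (dBaseList C B).Nodup := by
  refine List.nodup_append'.2 ⟨nodup_binaryBase, List.nodup_flatMap.2 ⟨fun c _ => ?_, ?_⟩, ?_⟩
  · refine List.Nodup.map_on ?_ ((hnd c).filter _)
    intro F hF G hG h
    have h := (Prod.ext_iff.1 h).1
    simp only at h
    rw [← hC.clb_maxElts hs ((hB c F).1 (List.mem_filter.1 hF).1).1,
      ← hC.clb_maxElts hs ((hB c G).1 (List.mem_filter.1 hG).1).1, h]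
  · refine (List.nodup_finRange n).imp fun {a b} hab => ?_
    rw [Function.onFun, List.disjoint_left]
    rintro i hi hi'
    obtain ⟨F, -, rfl⟩ := List.mem_map.1 hi
    obtain ⟨G, -, h⟩ := List.mem_map.1 hi'
    exact hab (Prod.ext_iff.1 h).2.symm
  · rw [List.disjoint_left]
    rintro i hi hi'
    obtain ⟨a, c, hc, rfl⟩ := mem_binaryBase.1 hi
    simp only [List.mem_flatMap, List.mem_map, List.mem_filter, decide_eq_true_eq, hB] at hi'
    obtain ⟨d, -, F, ⟨hF, hd⟩, h⟩ := hi'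
    obtain ⟨h₁, rfl⟩ := Prod.ext_iff.1 h
    simp only at h₁
    have := hF.isDGen_maxElts hC hs hd
    rw [h₁] at this
    exact not_isDGen_singleton (Finset.mem_sdiff.1 hc).1 this

/-- The minimal ideals without c give distinct entries of the `D`-base, and at most one minimal
ideal contains c. This keeps each dualization call output-polynomial in the final answer. -/
theorem IsClosureSystem.length_le_length_dBaseList (hC : IsClosureSystem C)
    (hB : ∀ c F, F ∈ B c ↔ IsMinDown C c F) (hnd : ∀ c, (B c).Nodup) (c : Fin n) :
    (B c).length ≤ (dBaseList C B).length + 1 := by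
  classical
  have h₁ : (B c).length = ((B c).filter fun F => decide (¬ c ∈ F)).length +
      ((B c).filter fun F => decide (c ∈ F)).length := by
    rw [List.length_eq_length_filter_add (l := B c) fun F => decide (c ∈ F), add_comm]
    simp
  have h₂ : ((B c).filter fun F => decide (c ∈ F)).length ≤ 1 := by
    rw [← List.toFinset_card_of_nodup ((hnd c).filter _), Finset.card_le_one]
    intro F hF G hG
    simp only [List.mem_toFinset, List.mem_filter, decide_eq_true_eq, hB] at hF hG
    rw [hF.1.eq_cl_singleton hC hF.2, hG.1.eq_cl_singleton hC hG.2]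
  have h₃ : ((B c).filter fun F => decide (¬ c ∈ F)).length ≤ (dBaseList C B).length := by
    have := (List.sublist_flatten_of_mem (List.mem_map_of_mem (f := fun c =>
      ((B c).filter fun F => decide (¬ c ∈ F)).map fun F => (maxElts C F, c))
        (List.mem_finRange c))).length_le
    rw [List.length_map, ← List.flatMap_def] at this
    rw [dBaseList, List.length_append]
    omega
  omega

end Binary

end ClosureSys

namespace MeetInstance

/-- The dualization instance whose answer consists of the minimal ideals that generate `c`. -/
noncomputable def dualInstance (i : MeetInstance) (c : Fin i.n) : DualInstance where
  n := i.n
  base := binaryBase i.closedFamily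
  base_nodup := nodup_binaryBase
  isStandard := i.isClosureSystem.isStandard_binaryBase i.isStandard
  isDistributive := isDistributive_binaryBase
  Bp := maximalAvoiding i.meets c
  Bp_nodup := i.meets_nodup.filter _
  isAntichain := isAntichainOf_maximalAvoiding i.mem_meets c

end MeetInstance

/-! ### The reduction to dualization in polynomial time -/

namespace WhileProg

open Polynomial

namespace PolyTime

section

variable {α : Type*} {sz : α → ℕ} {inp : α → Data} {i : α → MeetInstance}

theorem meetInstance_n (hi : PolyTime sz inp fun a => dBaseFromMeetIrreducibles.encInst (i a)) :
    PolyTime sz inp fun a => encNat (i a).n :=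
  hi.head

theorem meetInstance_meets
    (hi : PolyTime sz inp fun a => dBaseFromMeetIrreducibles.encInst (i a)) :
    PolyTime sz inp fun a => encList ((i a).meets.map encSet) :=
  hi.tail

/-- The closed family is not part of the input, so membership is tested on the listed
meet-irreducibles. -/
theorem mem_cl_singleton
    (hi : PolyTime sz inp fun a => dBaseFromMeetIrreducibles.encInst (i a))
    {x y : ∀ a, Fin (i a).n} (hx : PolyTime sz inp fun a => encNat (x a))
    (hy : PolyTime sz inp fun a => encNat (y a)) :
    PolyTime sz inp fun a => encProp (y a ∈ cl (i a).closedFamily {x a}) :=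
  (forall_mem (p := fun a M => x a ∈ M → y a ∈ M) hi.meetInstance_meets
    ((mem (i := fun z : (a : α) × Finset (Fin (i a).n) => x z.1) hx.weak last).imp
      (mem (i := fun z : (a : α) × Finset (Fin (i a).n) => y z.1) hy.weak last))).congr
    fun a => by simp [(i a).isClosureSystem.mem_cl_iff_meetIrreducibles, (i a).mem_meets]

theorem singleton {n : α → ℕ} {x : ∀ a, Fin (n a)} (hn : PolyTime sz inp fun a => encNat (n a))
    (hx : PolyTime sz inp fun a => encNat (x a)) :
    PolyTime sz inp fun a => encSet {x a} :=
  set hn ((fin_eq (n := fun z : (a : α) × Fin (n a) => n z.1) last hx.weak).congr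
    fun z => by simp)

theorem binaryBase (hi : PolyTime sz inp fun a => dBaseFromMeetIrreducibles.encInst (i a)) :
    PolyTime sz inp fun a =>
      encList ((ClosureSys.binaryBase (i a).closedFamily).map encImplication) := by
  refine (flatMap (L := fun a => List.finRange (i a).n) (e := fun a (x : Fin (i a).n) => encNat x)
    (G := fun a (x : Fin (i a).n) => (((List.finRange (i a).n).filter fun y =>
      decide (y ∈ cl (i a).closedFamily {x} ∧ ¬ y = x)).map fun y => ({x}, y)).map
        encImplication) hi.meetInstance_n.finRange ?_).congr fun a => ?_
  · simp only [List.map_map]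
    refine map (e := fun (z : (a : α) × Fin (i a).n) (y : Fin (i z.1).n) => encNat y)
      (filter (p := fun (z : (a : α) × Fin (i a).n) y =>
          y ∈ cl (i z.1).closedFamily {z.2} ∧ ¬ y = z.2)
        hi.weak.meetInstance_n.finRange ?_) ?_
    · exact (hi.weak.weak.mem_cl_singleton last.weak last).and
        (fin_eq (n := fun z : (z : (a : α) × Fin (i a).n) × Fin (i z.1).n => (i z.1.1).n)
          (i := fun z => z.2) (j := fun z => z.1.2) last last.weak).not
    · exact (singleton (n := fun z : (z : (a : α) × Fin (i a).n) × Fin (i z.1).n => (i z.1.1).n)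
        (x := fun z => z.1.2) hi.weak.weak.meetInstance_n last.weak).cons last
  · simp only [ClosureSys.binaryBase, List.map_flatMap]

theorem maximalAvoiding
    (hi : PolyTime sz inp fun a => dBaseFromMeetIrreducibles.encInst (i a))
    {c : ∀ a, Fin (i a).n} (hc : PolyTime sz inp fun a => encNat (c a)) :
    PolyTime sz inp fun a =>
      encList ((ClosureSys.maximalAvoiding (i a).meets (c a)).map encSet) := by
  refine filter (p := fun a M => ¬ c a ∈ M ∧ ∀ M' ∈ (i a).meets, ¬ c a ∈ M' → M ⊆ M' → M' ⊆ M)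
    hi.meetInstance_meets ?_
  refine (mem (n := fun z : (a : α) × Finset (Fin (i a).n) => (i z.1).n) (i := fun z => c z.1)
    (A := fun z => z.2) hc.weak last).not.and
    (forall_mem (p := fun (z : (a : α) × Finset (Fin (i a).n)) M' =>
        ¬ c z.1 ∈ M' → z.2 ⊆ M' → M' ⊆ z.2)
      hi.weak.meetInstance_meets ?_)
  have hn := hi.weak.weak.meetInstance_n (sz := extSize (extSize sz))
    (inp := extend (extend inp fun a (M : Finset (Fin (i a).n)) => encSet M)
      fun a (M : Finset (Fin (i a.1).n)) => encSet M)
  exact (mem (n := fun z : (z : (a : α) × Finset (Fin (i a).n)) × Finset (Fin (i z.1).n) =>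
      (i z.1.1).n)
    (i := fun z => c z.1.1)
    (A := fun z => z.2) hc.weak.weak last).not.imp
    ((subset hn last.weak last).imp (subset hn last last.weak))

theorem maxElts (hi : PolyTime sz inp fun a => dBaseFromMeetIrreducibles.encInst (i a))
    {F : ∀ a, Finset (Fin (i a).n)} (hF : PolyTime sz inp fun a => encSet (F a)) :
    PolyTime sz inp fun a => encSet (ClosureSys.maxElts (i a).closedFamily (F a)) := by
  refine set hi.meetInstance_n
    (((mem (n := fun z : (a : α) × Fin (i a).n => (i z.1).n) last hF.weak).and
    (forall_fin (n := fun z : (a : α) × Fin (i a).n => (i z.1).n)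
      (p := fun (z : (a : α) × Fin (i a).n) y =>
        y ∈ F z.1 → z.2 ∈ cl (i z.1).closedFamily {y} → z.2 = y)
      hi.weak.meetInstance_n ?_)).congr fun z => by simp [ClosureSys.maxElts])
  refine imp (mem (n := fun z : (z : (a : α) × Fin (i a).n) × Fin (i z.1).n => (i z.1.1).n)
    (i := fun z => z.2) last hF.weak.weak)
    (imp (hi.weak.weak.mem_cl_singleton last last.weak) ?_)
  exact fin_eq (n := fun z : (z : (a : α) × Fin (i a).n) × Fin (i z.1).n => (i z.1.1).n)
    (i := fun z => z.1.2) (j := fun z => z.2) last.weak last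

theorem encInst_dualInstance
    (hi : PolyTime sz inp fun a => dBaseFromMeetIrreducibles.encInst (i a))
    {c : ∀ a, Fin (i a).n} (hc : PolyTime sz inp fun a => encNat (c a)) :
    PolyTime sz inp fun a => distributiveDualization.encInst ((i a).dualInstance (c a)) :=
  hi.meetInstance_n.cons (hi.binaryBase.cons (hi.maximalAvoiding hc))

theorem dBaseList (hi : PolyTime sz inp fun a => dBaseFromMeetIrreducibles.encInst (i a))
    {B : ∀ a, Fin (i a).n → List (Finset (Fin (i a).n))}
    (hB : PolyTime (extSize sz) (extend inp fun a (c : Fin (i a).n) => encNat c)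
      fun z => encList ((B z.1 z.2).map encSet)) :
    PolyTime sz inp fun a =>
      encList ((ClosureSys.dBaseList (i a).closedFamily (B a)).map encImplication) := by
  refine (hi.binaryBase.append (flatMap (L := fun a => List.finRange (i a).n)
    (e := fun a (x : Fin (i a).n) => encNat x) (G := fun a (c : Fin (i a).n) =>
      (((B a c).filter fun F =>
      decide (¬ c ∈ F)).map fun F => (ClosureSys.maxElts (i a).closedFamily F, c)).map
        encImplication) hi.meetInstance_n.finRange ?_)).congr fun a => ?_
  · simp only [List.map_map]
    refine map (e := fun (z : (a : α) × Fin (i a).n) (F : Finset (Fin (i z.1).n)) => encSet F)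
      (filter (p := fun (z : (a : α) × Fin (i a).n) F => ¬ z.2 ∈ F) hB ?_) ?_
    · exact (mem (n := fun z : (z : (a : α) × Fin (i a).n) × Finset (Fin (i z.1).n) =>
          (i z.1.1).n)
        (i := fun z => z.1.2) (A := fun z => z.2) last.weak last).not
    · exact (hi.weak.weak.maxElts last).cons last.weak
  · simp only [ClosureSys.dBaseList, List.map_append, List.map_flatMap]

end

end PolyTime

theorem outputPolynomial_dBase_of_dualization (h : distributiveDualization.OutputPolynomial) :
    dBaseFromMeetIrreducibles.OutputPolynomial := by
  rw [EnumProblem.outputPolynomial_iff] at h ⊢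
  obtain ⟨L, hL, hP⟩ := h
  let B : ∀ i : MeetInstance, Fin i.n → List (Finset (Fin i.n)) := fun i c => L (i.dualInstance c)
  have hB : ∀ i c F, F ∈ B i c ↔ IsMinDown i.closedFamily c F := fun i c =>
    (i.isClosureSystem.areDual_maximalAvoiding_iff i.mem_meets).1 (hL (i.dualInstance c)).2
  have hnd : ∀ i c, (B i c).Nodup := fun i c => (hL (i.dualInstance c)).1
  refine ⟨fun i => dBaseList i.closedFamily (B i), fun i =>
    ⟨i.isClosureSystem.nodup_dBaseList i.isStandard (hB i) (hnd i), ?_⟩,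
    .dBaseList .id ?_⟩
  · ext x
    exact i.isClosureSystem.mem_dBaseList_iff i.isStandard (hB i)
  · refine (PolyTime.encInst_dualInstance (i := fun z : (i : MeetInstance) × Fin i.n => z.1)
      -- The polynomial bounds the output of a call: its length is at most one more than that of the
      -- `D`-base, and each set takes at most `4 * n + 1` nodes.
      PolyTime.id.weak PolyTime.last).comp ((hP.reindex fun z : (i : MeetInstance) × Fin i.n =>
        z.1.dualInstance z.2).mono ((X + 2) * (4 * X + 2) + 1) ?_)
    rintro ⟨i, c⟩
    have h₁ : i.n ≤ (distributiveDualization.encInst (i.dualInstance c)).size := by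
      have := size_encNat i.n
      simp only [distributiveDualization, MeetInstance.dualInstance, Data.size]
      omega
    have h₂ := i.isClosureSystem.length_le_length_dBaseList (hB i) (hnd i) c
    have h₃ := length_le_encList ((dBaseList i.closedFamily (B i)).map encImplication)
    rw [List.length_map] at h₃
    refine (encList_size_le (m := 4 * i.n + 1) fun d hd => ?_).trans ?_
    · obtain ⟨F, -, rfl⟩ := List.mem_map.1 hd
      exact size_encSet_le F
    · simp only [List.length_map, eval_add, eval_mul, eval_X, eval_ofNat, eval_one,
        Function.comp, extSize]
      refine Nat.add_le_add_right (Nat.mul_le_mul (le_trans h₂ ?_) (by omega)) 1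
      change _ ≤ (encList ((dBaseList i.closedFamily (B i)).map encImplication)).size + _ + _
      omega

end WhileProg

/-! ### From the `D`-base to dualization -/

namespace ClosureSys

/-! ### Closures by forward chaining -/

section Iterate

variable {n : ℕ}

/-- One round of forward chaining with the implications in `S`. -/
def chainStep (S : List (Implication (Fin n))) (F : Finset (Fin n)) : Finset (Fin n) :=
  Finset.univ.filter fun y => y ∈ F ∨ ∃ i ∈ S, i.1 ⊆ F ∧ i.2 = y

variable {S : List (Implication (Fin n))}

theorem subset_chainStep (F : Finset (Fin n)) : F ⊆ chainStep S F := fun x hx => by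
  simp [chainStep, hx]

theorem mem_closedSets_of_chainStep_eq {F : Finset (Fin n)} (h : chainStep S F = F) :
    F ∈ closedSets S :=
  mem_closedSets.2 fun i hi hsub => by
    rw [← h]
    exact Finset.mem_filter.2 ⟨Finset.mem_univ _, Or.inr ⟨i, hi, hsub, rfl⟩⟩

theorem chainStep_subset {F G : Finset (Fin n)} (hG : G ∈ closedSets S) (h : F ⊆ G) :
    chainStep S F ⊆ G := by
  intro x hx
  rcases (Finset.mem_filter.1 hx).2 with hx | ⟨i, hi, hsub, rfl⟩
  · exact h hx
  · exact mem_closedSets.1 hG i hi (hsub.trans h)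

/-- Each round that is not stationary adds an element, so after `n` rounds the set is stationary or
is the whole ground set. -/
theorem iterate_chainStep (A : Finset (Fin n)) :
    (chainStep S)^[n] A = cl (closedSets S) A := by
  have hsub : ∀ k, A ⊆ (chainStep S)^[k] A := by
    intro k
    induction k with
    | zero => exact subset_rfl
    | succ k ih =>
      rw [Function.iterate_succ_apply']
      exact ih.trans (subset_chainStep _)
  have hle : ∀ k, (chainStep S)^[k] A ⊆ cl (closedSets S) A := by
    intro k
    induction k with
    | zero => exact subset_cl A
    | succ k ih =>
      rw [Function.iterate_succ_apply']
      exact chainStep_subset ((isClosureSystem_closedSets S).cl_mem A) ih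
  have hfix : ∀ k, chainStep S ((chainStep S)^[k] A) = (chainStep S)^[k] A ∨
      k ≤ ((chainStep S)^[k] A).card := by
    intro k
    induction k with
    | zero => simp
    | succ k ih =>
      rw [Function.iterate_succ_apply']
      by_cases h : chainStep S ((chainStep S)^[k] A) = (chainStep S)^[k] A
      · left; rw [h, h]
      · right
        have := Finset.card_lt_card (Finset.ssubset_iff_subset_ne.2
          ⟨subset_chainStep (S := S) ((chainStep S)^[k] A), fun h' => h h'.symm⟩)
        have := ih.resolve_left h
        omega
  refine (hle n).antisymm (cl_subset (mem_closedSets_of_chainStep_eq ?_) (hsub n))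
  refine (hfix n).elim id fun h => ?_
  have : (chainStep S)^[n] A = Finset.univ :=
    Finset.eq_univ_of_card _ (le_antisymm (Finset.card_le_univ _) (by simpa using h))
  rw [this]
  exact (Finset.subset_univ _).antisymm (subset_chainStep _)

end Iterate

/-! ### Closed sets of standard distributive systems are the order ideals -/

section Distributive

variable {U : Type} [Fintype U] [DecidableEq U] {C : Finset (Finset U)}

theorem IsDistributive.clb_mem (hd : IsDistributive C) (hC : IsClosureSystem C)
    (hs : IsStandard C) (A : Finset U) : clb C A ∈ C := by
  induction A using Finset.induction_on with
  | empty =>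
    have := hC.cl_mem ∅
    rwa [hs.cl_empty] at this
  | insert a A _ ih =>
    rw [clb, Finset.biUnion_insert]
    exact hd _ (hC.cl_mem _) _ ih

theorem IsDistributive.cl_eq_clb (hd : IsDistributive C) (hC : IsClosureSystem C)
    (hs : IsStandard C) (A : Finset U) : cl C A = clb C A := by
  rw [← hC.cl_clb, cl_eq_self (hd.clb_mem hC hs A)]

theorem IsDistributive.mem_of_isDown (hd : IsDistributive C) (hC : IsClosureSystem C)
    (hs : IsStandard C) {F : Finset U} (hF : IsDown C F) : F ∈ C := by
  have := hd.clb_mem hC hs F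
  rwa [(hF.clb_subset subset_rfl).antisymm (subset_clb F)] at this

/-- `F` is a minimal closed set outside the order ideal of `B`. -/
def IsMinOutside (C : Finset (Finset U)) (B : List (Finset U)) (F : Finset U) : Prop :=
  F ∈ C ∧ (∀ G ∈ B, ¬ F ⊆ G) ∧ ∀ F' ∈ C, F' ⊆ F → (∀ G ∈ B, ¬ F' ⊆ G) → F' = F

theorem exists_isMinOutside {B : List (Finset U)} {F : Finset U} (hF : F ∈ C)
    (h : ∀ G ∈ B, ¬ F ⊆ G) : ∃ H ⊆ F, IsMinOutside C B H := by
  classical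
  obtain ⟨H, hHF, hH⟩ := (C.filter fun G => ∀ K ∈ B, ¬ G ⊆ K).exists_le_minimal
    (Finset.mem_filter.2 ⟨hF, h⟩)
  have hH' := Finset.mem_filter.1 hH.prop
  exact ⟨H, hHF, hH'.1, hH'.2, fun F' hF' hsub hFp' =>
    hH.eq_of_le (Finset.mem_filter.2 ⟨hF', hFp'⟩) hsub⟩

end Distributive

/-! ### The cone: a new point that detects leaving the ideal of `B` -/

section Cone

variable {n : ℕ}

/-- The trace of a subset of `{0, …, n}` on `{1, …, n}`. -/
def trace (F : Finset (Fin (n + 1))) : Finset (Fin n) :=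
  Finset.univ.filter fun i => i.succ ∈ F

/-- A subset of `{1, …, n}` as a subset of `{0, …, n}`. -/
def shift (F : Finset (Fin n)) : Finset (Fin (n + 1)) := F.map (Fin.succEmb n)

/-- A subset of `{1, …, n}` together with `0`. -/
def shiftZero (F : Finset (Fin n)) : Finset (Fin (n + 1)) := insert 0 (shift F)

@[simp] theorem mem_trace {F : Finset (Fin (n + 1))} {i : Fin n} : i ∈ trace F ↔ i.succ ∈ F := by
  simp [trace]

@[simp] theorem succ_mem_shift {F : Finset (Fin n)} {i : Fin n} : i.succ ∈ shift F ↔ i ∈ F := by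
  simp [shift]

@[simp] theorem zero_notMem_shift {F : Finset (Fin n)} : 0 ∉ shift F := by
  simp [shift]

@[simp] theorem succ_mem_shiftZero {F : Finset (Fin n)} {i : Fin n} :
    i.succ ∈ shiftZero F ↔ i ∈ F := by
  simp [shiftZero]

@[simp] theorem zero_mem_shiftZero {F : Finset (Fin n)} : 0 ∈ shiftZero F := by
  simp [shiftZero]

@[simp] theorem trace_shift (F : Finset (Fin n)) : trace (shift F) = F := by ext; simp

@[simp] theorem trace_shiftZero (F : Finset (Fin n)) : trace (shiftZero F) = F := by ext; simp

@[simp] theorem trace_singleton_succ (i : Fin n) : trace {i.succ} = {i} := by ext; simp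

@[simp] theorem trace_singleton_zero : trace ({0} : Finset (Fin (n + 1))) = ∅ := by
  ext; simp [Fin.succ_ne_zero]

theorem trace_mono {F G : Finset (Fin (n + 1))} (h : F ⊆ G) : trace F ⊆ trace G := fun i hi => by
  rw [mem_trace] at *; exact h hi

theorem subset_iff_trace {F G : Finset (Fin (n + 1))} :
    F ⊆ G ↔ (0 ∈ F → 0 ∈ G) ∧ trace F ⊆ trace G := by
  refine ⟨fun h => ⟨fun h0 => h h0, trace_mono h⟩, fun h x hx => ?_⟩
  cases x using Fin.cases with
  | zero => exact h.1 hx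
  | succ i => exact mem_trace.1 (h.2 (mem_trace.2 hx))

theorem eq_of_trace_eq {F G : Finset (Fin (n + 1))} (h₀ : 0 ∈ F ↔ 0 ∈ G)
    (h : trace F = trace G) : F = G :=
  (subset_iff_trace.2 ⟨h₀.1, h.subset⟩).antisymm (subset_iff_trace.2 ⟨h₀.2, h.symm.subset⟩)

/-- The closed sets of `C` in the order ideal of `B`, and all sets `F ∪ {0}` with `F ∈ C`. -/
def coneSystem (C : Finset (Finset (Fin n))) (B : List (Finset (Fin n))) :
    Finset (Finset (Fin (n + 1))) :=
  Finset.univ.filter fun F => trace F ∈ C ∧ (0 ∈ F ∨ ∃ G ∈ B, trace F ⊆ G)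

variable {C : Finset (Finset (Fin n))} {B : List (Finset (Fin n))}

theorem mem_coneSystem {F : Finset (Fin (n + 1))} :
    F ∈ coneSystem C B ↔ trace F ∈ C ∧ (0 ∈ F ∨ ∃ G ∈ B, trace F ⊆ G) := by
  simp [coneSystem]

theorem shiftZero_mem_coneSystem {F : Finset (Fin n)} (hF : F ∈ C) :
    shiftZero F ∈ coneSystem C B :=
  mem_coneSystem.2 ⟨by simpa using hF, Or.inl zero_mem_shiftZero⟩

theorem IsClosureSystem.coneSystem (hC : IsClosureSystem C) (B : List (Finset (Fin n))) :
    IsClosureSystem (coneSystem C B) := by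
  refine ⟨mem_coneSystem.2 ⟨?_, Or.inl (Finset.mem_univ _)⟩, fun F hF G hG => ?_⟩
  · have : trace (Finset.univ : Finset (Fin (n + 1))) = Finset.univ := by ext; simp
    rw [this]; exact hC.1
  · rw [mem_coneSystem] at *
    have h : trace (F ∩ G) = trace F ∩ trace G := by ext; simp
    rw [h]
    refine ⟨hC.2 _ hF.1 _ hG.1, ?_⟩
    rcases hF.2 with h₁ | ⟨K, hK, hFK⟩
    · rcases hG.2 with h₂ | ⟨K, hK, hGK⟩
      · exact Or.inl (Finset.mem_inter.2 ⟨h₁, h₂⟩)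
      · exact Or.inr ⟨K, hK, Finset.inter_subset_right.trans hGK⟩
    · exact Or.inr ⟨K, hK, Finset.inter_subset_left.trans hFK⟩

/-- Adding 0 to any closed set of `C` gives a closed set, so the new point does not affect the
closure on old points. -/
theorem IsClosureSystem.succ_mem_cl_coneSystem (hC : IsClosureSystem C)
    {A : Finset (Fin (n + 1))} {i : Fin n} :
    i.succ ∈ cl (ClosureSys.coneSystem C B) A ↔ i ∈ cl C (trace A) := by
  constructor
  · intro h
    simpa using mem_cl.1 h (shiftZero (cl C (trace A))) (shiftZero_mem_coneSystem (hC.cl_mem _))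
      (subset_iff_trace.2 (by simpa using subset_cl _))
  · exact fun h => mem_cl.2 fun F hF hAF =>
      mem_trace.1 (mem_cl.1 h _ (mem_coneSystem.1 hF).1 (trace_mono hAF))

/-- If 0 ∉ A and the old closure lies below some member of `B`, that closure without 0 is still
closed in the cone. Otherwise every closed set containing A is forced to contain 0. -/
theorem IsClosureSystem.zero_mem_cl_coneSystem (hC : IsClosureSystem C)
    {A : Finset (Fin (n + 1))} :
    0 ∈ cl (ClosureSys.coneSystem C B) A ↔ 0 ∈ A ∨ ∀ G ∈ B, ¬ cl C (trace A) ⊆ G := by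
  constructor
  · intro h
    by_contra! hA
    obtain ⟨hA, G, hG, hsub⟩ := hA
    refine zero_notMem_shift (mem_cl.1 h (shift (cl C (trace A)))
      (mem_coneSystem.2 ⟨by simpa using hC.cl_mem _, Or.inr ⟨G, hG, by simpa using hsub⟩⟩)
      (subset_iff_trace.2 ⟨fun h => absurd h hA, by simpa using subset_cl _⟩))
  · rintro h
    refine mem_cl.2 fun F hF hAF => h.elim (fun h => hAF h) fun h => ?_
    obtain ⟨h₁, h₂⟩ := mem_coneSystem.1 hF
    refine h₂.resolve_right ?_
    rintro ⟨G, hG, hFG⟩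
    exact h G hG ((cl_subset h₁ (trace_mono hAF)).trans hFG)

/-- A member of `B` is needed for the empty set to be closed; with `B` empty, every closed set would
contain 0. -/
theorem IsStandard.coneSystem (hs : IsStandard C) (hC : IsClosureSystem C) (hne : B ≠ []) :
    IsStandard (coneSystem C B) := by
  intro a
  obtain ⟨G, hG⟩ := List.exists_mem_of_ne_nil B hne
  have ht : ∀ x : Fin (n + 1), trace (cl (ClosureSys.coneSystem C B) {x}) = cl C (trace {x}) :=
    fun x => by ext i; simp [hC.succ_mem_cl_coneSystem]
  cases a using Fin.cases with
  | zero =>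
    have h : trace (cl (ClosureSys.coneSystem C B) {0} \ {0}) = ∅ := by
      rw [← hs.cl_empty, ← trace_singleton_zero (n := n), ← ht]
      ext i; simp [Fin.succ_ne_zero]
    refine mem_coneSystem.2 ⟨?_, Or.inr ⟨G, hG, by simp [h]⟩⟩
    rw [h, ← hs.cl_empty]
    exact hC.cl_mem ∅
  | succ i =>
    have h : trace (cl (ClosureSys.coneSystem C B) {i.succ} \ {i.succ}) = cl C {i} \ {i} := by
      ext j; simp [hC.succ_mem_cl_coneSystem]
    rw [mem_coneSystem, h]
    refine ⟨hs i, ?_⟩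
    by_cases h₀ : 0 ∈ cl (ClosureSys.coneSystem C B) {i.succ}
    · exact Or.inl (by simp [h₀, (Fin.succ_ne_zero i).symm])
    · right
      rw [hC.zero_mem_cl_coneSystem, trace_singleton_succ] at h₀
      push Not at h₀
      obtain ⟨G, hG, hsub⟩ := h₀.2
      exact ⟨G, hG, Finset.sdiff_subset.trans hsub⟩

/-! ### The meet-irreducible elements of the cone -/

/-- The elements whose closure does not contain `a`. -/
def notAbove (C : Finset (Finset (Fin n))) (a : Fin n) : Finset (Fin n) :=
  Finset.univ.filter fun b => ¬ a ∈ cl C {b}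

theorem mem_notAbove {a b : Fin n} : b ∈ notAbove C a ↔ a ∉ cl C {b} := by simp [notAbove]

theorem notMem_notAbove (a : Fin n) : a ∉ notAbove C a := by
  simp [mem_notAbove, mem_cl_self]

theorem IsDown.subset_notAbove {F : Finset (Fin n)} (hF : IsDown C F) {a : Fin n} (ha : a ∉ F) :
    F ⊆ notAbove C a := fun b hb => mem_notAbove.2 fun h => ha (hF b hb h)

theorem IsDistributive.notAbove_mem (hd : IsDistributive C) (hC : IsClosureSystem C)
    (hs : IsStandard C) (a : Fin n) : notAbove C a ∈ C :=
  hd.mem_of_isDown hC hs fun _ hb _ hx => mem_notAbove.2 fun h =>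
    mem_notAbove.1 hb (hC.cl_singleton_subset hx h)

/-- The meet-irreducible elements of `coneSystem C B`. -/
def coneMeets (C : Finset (Finset (Fin n))) (B : List (Finset (Fin n))) :
    List (Finset (Fin (n + 1))) :=
  ((List.finRange n).map fun a => shiftZero (notAbove C a)) ++ B.map shift

theorem nodup_coneMeets (hs : IsStandard C) (hB : B.Nodup) : (coneMeets C B).Nodup := by
  refine List.nodup_append'.2 ⟨(List.nodup_finRange n).map fun a b h => ?_,
    hB.map fun F G h => ?_, ?_⟩
  · have h : notAbove C a = notAbove C b := by
      simpa using congrArg trace h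
    have h₁ := notMem_notAbove (C := C) a
    have h₂ := notMem_notAbove (C := C) b
    rw [h, mem_notAbove, not_not] at h₁
    rw [← h, mem_notAbove, not_not] at h₂
    exact hs.antisymm h₂ h₁
  · simpa using congrArg trace h
  · rw [List.disjoint_left]
    intro F hF hF'
    obtain ⟨a, -, rfl⟩ := List.mem_map.1 hF
    obtain ⟨G, -, h⟩ := List.mem_map.1 hF'
    exact zero_notMem_shift (h ▸ zero_mem_shiftZero)

/-- By distributivity the elements not above a, together with 0, form the largest closed set
avoiding a; by the antichain property the members of `B` are the maximal closed sets avoiding 0.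
Every closed set avoiding a point extends to one of these. -/
theorem mem_coneMeets_iff (hC : IsClosureSystem C) (hs : IsStandard C) (hd : IsDistributive C)
    (hB : IsAntichainOf C {G | G ∈ B}) {M : Finset (Fin (n + 1))} :
    M ∈ coneMeets C B ↔ M ∈ meetIrreducibles (coneSystem C B) := by
  have hshift : ∀ G ∈ B, shift G ∈ coneSystem C B := fun G hG =>
    mem_coneSystem.2 ⟨by simpa using hB.1 G hG, Or.inr ⟨G, hG, by simp⟩⟩
  have hzero : ∀ a, shiftZero (notAbove C a) ∈ coneSystem C B := fun a =>
    shiftZero_mem_coneSystem (hd.notAbove_mem hC hs a)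
  constructor
  · intro hM
    rcases List.mem_append.1 hM with hM | hM
    · obtain ⟨a, -, rfl⟩ := List.mem_map.1 hM
      refine mem_meetIrreducibles_of_maximal (x := a.succ) (hzero a)
        (by simpa using notMem_notAbove a) fun G hG hsub haG => ?_
      refine Finset.Subset.antisymm (subset_iff_trace.2 ⟨fun _ => zero_mem_shiftZero, ?_⟩) hsub
      rw [trace_shiftZero]
      exact (isDown_of_mem (mem_coneSystem.1 hG).1).subset_notAbove (by simpa using haG)
    · obtain ⟨F, hF, rfl⟩ := List.mem_map.1 hM
      refine mem_meetIrreducibles_of_maximal (x := 0) (hshift F hF)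
        zero_notMem_shift fun G hG hsub h₀ => ?_
      obtain ⟨K, hK, hGK⟩ := (mem_coneSystem.1 hG).2.resolve_left h₀
      have hFG : F ⊆ trace G := by simpa using trace_mono hsub
      have : F = K := hB.2.eq hF hK (hFG.trans hGK)
      subst this
      exact eq_of_trace_eq (by simp [h₀]) (by simpa using hGK.antisymm hFG)
  · intro hM
    rw [← List.mem_toFinset]
    refine (hC.coneSystem B).mem_of_mem_meetIrreducibles (fun F hF => ?_) (fun F hF x hx => ?_) hM
    · rcases List.mem_append.1 (List.mem_toFinset.1 hF) with hF | hF
      · obtain ⟨a, -, rfl⟩ := List.mem_map.1 hF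
        exact hzero a
      · obtain ⟨G, hG, rfl⟩ := List.mem_map.1 hF
        exact hshift G hG
    · obtain ⟨h₁, h₂⟩ := mem_coneSystem.1 hF
      cases x using Fin.cases with
      | zero =>
        obtain ⟨G, hG, hFG⟩ := h₂.resolve_left hx
        exact ⟨shift G, by simpa [coneMeets] using Or.inr ⟨G, hG, rfl⟩,
          subset_iff_trace.2 ⟨fun h => absurd h hx, by simpa using hFG⟩, zero_notMem_shift⟩
      | succ i =>
        refine ⟨shiftZero (notAbove C i), by simp [coneMeets],
          subset_iff_trace.2 ⟨fun _ => zero_mem_shiftZero, ?_⟩, by simpa using notMem_notAbove i⟩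
        rw [trace_shiftZero]
        exact (isDown_of_mem h₁).subset_notAbove (by simpa using hx)

/-! ### The `D`-base of the cone -/

theorem succ_mem_clb_coneSystem (hC : IsClosureSystem C) (hs : IsStandard C)
    (hd : IsDistributive C) {A : Finset (Fin (n + 1))} {i : Fin n} :
    i.succ ∈ clb (coneSystem C B) A ↔ i ∈ cl C (trace A) := by
  rw [hd.cl_eq_clb hC hs, mem_clb, mem_clb]
  constructor
  · rintro ⟨a, ha, h⟩
    rw [hC.succ_mem_cl_coneSystem] at h
    cases a using Fin.cases with
    | zero => simp [hs.cl_empty] at h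
    | succ j => exact ⟨j, by simpa using ha, by simpa using h⟩
  · rintro ⟨j, hj, h⟩
    exact ⟨j.succ, by simpa using hj, by simpa [hC.succ_mem_cl_coneSystem] using h⟩

theorem mem_dBase {U : Type} [Fintype U] [DecidableEq U] {C : Finset (Finset U)}
    {A : Finset U} {c : U} :
    (A, c) ∈ dBase C ↔ (∃ a, c ∈ cl C {a} ∧ c ≠ a ∧ A = {a}) ∨ IsDGen C A c := by
  constructor
  · rintro (⟨a, d, h, he⟩ | ⟨A', d, h, he⟩) <;> rw [Prod.mk.injEq] at he <;>
      obtain ⟨rfl, rfl⟩ := he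
    · exact Or.inl ⟨a, by simpa using h⟩
    · exact Or.inr h
  · rintro (⟨a, h₁, h₂, rfl⟩ | h)
    · exact Or.inl ⟨a, c, by simp [h₁, h₂], rfl⟩
    · exact Or.inr ⟨A, c, h, rfl⟩

theorem not_cl_trace_subset_of_mem_dBase (hC : IsClosureSystem C) {A : Finset (Fin (n + 1))}
    (hA : (A, 0) ∈ dBase (coneSystem C B)) : ∀ G ∈ B, ¬ cl C (trace A) ⊆ G := by
  rcases mem_dBase.1 hA with ⟨a, h, hne, rfl⟩ | h
  · exact (hC.zero_mem_cl_coneSystem.1 h).resolve_left (by simpa using hne)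
  · exact (hC.zero_mem_cl_coneSystem.1 h.1.1).resolve_left fun h₀ => h.2.1 (subset_clb A h₀)

/-- By distributivity cl and cl^b agree on old points, so only 0 can have a `D`-generator. A closed
F ⊆ cl(A) outside the ideal generates 0, hence contains a minimal generator of 0, which is A by
uniqueness. -/
theorem IsDGen.coneSystem (hC : IsClosureSystem C) (hs : IsStandard C)
    (hd : IsDistributive C) {A : Finset (Fin (n + 1))} {c : Fin (n + 1)}
    (hA : IsDGen (coneSystem C B) A c) : c = 0 ∧ IsMinOutside C B (cl C (trace A)) := by
  obtain rfl : c = 0 := by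
    cases c using Fin.cases with
    | zero => rfl
    | succ i =>
      exact absurd ((succ_mem_clb_coneSystem hC hs hd).2 (hC.succ_mem_cl_coneSystem.1 hA.1.1))
        hA.2.1
  refine ⟨rfl, hC.cl_mem _, not_cl_trace_subset_of_mem_dBase hC (mem_dBase.2 (Or.inr hA)),
    fun F hF hsub hFB => ?_⟩
  have h₀ : 0 ∈ cl (ClosureSys.coneSystem C B) (shift F) :=
    hC.zero_mem_cl_coneSystem.2 (Or.inr (by simpa [cl_eq_self hF] using hFB))
  obtain ⟨A', hA'F, hA'⟩ := exists_isMinGen h₀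
  obtain rfl := hA.2.2 A' hA' fun x hx => by
    cases x using Fin.cases with
    | zero => exact absurd (hA'F hx) zero_notMem_shift
    | succ i =>
      exact (succ_mem_clb_coneSystem hC hs hd).2 (hsub (succ_mem_shift.1 (hA'F hx)))
  exact hsub.antisymm (cl_subset hF (by simpa using trace_mono hA'F))

/-- If some a ∈ F already has its closure outside the ideal, then F = cl(a) and a → 0 is the
required implication. Otherwise F, without 0, is a minimal ideal generating 0 in the cone, and its
maximal elements form a `D`-generator. -/
theorem exists_mem_dBase_of_isMinOutside (hC : IsClosureSystem C) (hs : IsStandard C)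
    (hd : IsDistributive C) (hne : B ≠ []) {F : Finset (Fin n)} (hF : IsMinOutside C B F) :
    ∃ A, (A, 0) ∈ dBase (coneSystem C B) ∧ cl C (trace A) = F := by
  by_cases h : ∃ a ∈ F, ∀ G ∈ B, ¬ cl C {a} ⊆ G
  · obtain ⟨a, haF, ha⟩ := h
    refine ⟨{a.succ}, mem_dBase.2 (Or.inl ⟨a.succ, ?_, (Fin.succ_ne_zero a).symm, rfl⟩), ?_⟩
    · exact hC.zero_mem_cl_coneSystem.2 (Or.inr (by simpa using ha))
    · rw [trace_singleton_succ]
      exact hF.2.2 _ (hC.cl_mem _) (isDown_of_mem hF.1 a haF) ha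
  · push Not at h
    have hmin : IsMinDown (coneSystem C B) 0 (shift F) := by
      refine ⟨fun x hx => ?_, ?_, fun F' hF' hdown h₀ => ?_⟩
      · cases x using Fin.cases with
        | zero => exact absurd hx zero_notMem_shift
        | succ a =>
          rw [succ_mem_shift] at hx
          refine subset_iff_trace.2 ⟨fun h₀ => ?_, fun i hi => ?_⟩
          · have := (hC.zero_mem_cl_coneSystem.1 h₀).resolve_left
              (by simpa using (Fin.succ_ne_zero a).symm)
            obtain ⟨G, hG, hsub⟩ := h a hx
            exact absurd (by simpa using hsub) (this G hG)
          · rw [mem_trace, hC.succ_mem_cl_coneSystem, trace_singleton_succ] at hi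
            simpa using isDown_of_mem hF.1 a hx hi
      · exact hC.zero_mem_cl_coneSystem.2 (Or.inr (by simpa [cl_eq_self hF.1] using hF.2.1))
      · have h0F' : 0 ∉ F' := fun h => zero_notMem_shift (hF' h)
        have htd : IsDown C (trace F') := fun i hi j hj =>
          mem_trace.2 (hdown i.succ (mem_trace.1 hi)
            (hC.succ_mem_cl_coneSystem.2 (by simpa using hj)))
        have htC := hd.mem_of_isDown hC hs htd
        refine eq_of_trace_eq (by simp [h0F']) ?_
        rw [trace_shift]
        refine hF.2.2 _ htC (by simpa using trace_mono hF') ?_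
        simpa [cl_eq_self htC] using (hC.zero_mem_cl_coneSystem.1 h₀).resolve_left h0F'
    have hD := hmin.isDGen_maxElts (hC.coneSystem B) (hs.coneSystem hC hne) zero_notMem_shift
    refine ⟨_, mem_dBase.2 (Or.inr hD), ?_⟩
    ext i
    rw [← succ_mem_clb_coneSystem (B := B) hC hs hd,
      (hC.coneSystem B).clb_maxElts (hs.coneSystem hC hne) hmin.1, succ_mem_shift]

/-- Two singletons agree by antisymmetry, and two `D`-generators with the same closure lie in each
other's cl^b. -/
theorem eq_of_mem_dBase_of_cl_trace_eq (hC : IsClosureSystem C) (hs : IsStandard C)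
    (hd : IsDistributive C) {A₁ A₂ : Finset (Fin (n + 1))}
    (h₁ : (A₁, 0) ∈ dBase (coneSystem C B)) (h₂ : (A₂, 0) ∈ dBase (coneSystem C B))
    (h : cl C (trace A₁) = cl C (trace A₂)) : A₁ = A₂ := by
  -- A `D`-generator A with the closure of a would have a, and therefore 0, in cl^b(A).
  have mixed : ∀ {a A}, 0 ∈ cl (coneSystem C B) {a} → 0 ≠ a → IsDGen (coneSystem C B) A 0 →
      cl C (trace {a}) ≠ cl C (trace A) := by
    intro a A h₁ h₂ hA heq
    cases a using Fin.cases with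
    | zero => exact h₂ rfl
    | succ i =>
      have : i.succ ∈ clb (coneSystem C B) A := by
        rw [succ_mem_clb_coneSystem hC hs hd, ← heq, trace_singleton_succ]
        exact mem_cl_self i
      exact hA.2.1 ((hC.coneSystem B).isDown_clb A _ this h₁)
  rcases mem_dBase.1 h₁ with ⟨a, ha, ha₀, rfl⟩ | hA₁ <;>
    rcases mem_dBase.1 h₂ with ⟨b, hb, hb₀, rfl⟩ | hA₂
  · cases a using Fin.cases with
    | zero => exact absurd rfl ha₀
    | succ i =>
      cases b using Fin.cases with
      | zero => exact absurd rfl hb₀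
      | succ j =>
        simp only [trace_singleton_succ] at h
        obtain rfl : i = j := hs.antisymm (by rw [← h]; exact mem_cl_self i)
          (by rw [h]; exact mem_cl_self j)
        rfl
  · exact absurd h (mixed ha ha₀ hA₂)
  · exact absurd h.symm (mixed hb hb₀ hA₁)
  · refine hA₂.2.2 A₁ hA₁.1 fun x hx => ?_
    cases x using Fin.cases with
    | zero => exact absurd (subset_clb _ hx) hA₁.2.1
    | succ i =>
      rw [succ_mem_clb_coneSystem hC hs hd, ← h]
      exact subset_cl _ (mem_trace.2 hx)

/-- The closed sets of `C` that are generated by the premises of the implications `A → 0`. -/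
def coneCandidates (C : Finset (Finset (Fin n))) (L : List (Implication (Fin (n + 1)))) :
    List (Finset (Fin n)) :=
  (L.filter fun i => decide (i.2 = 0)).map fun i => cl C (trace i.1)

/-- The minimal ones among the candidates. -/
def coneDual (C : Finset (Finset (Fin n))) (L : List (Implication (Fin (n + 1)))) :
    List (Finset (Fin n)) :=
  (coneCandidates C L).filter fun F => decide (∀ G ∈ coneCandidates C L, G ⊆ F → F ⊆ G)

variable {L : List (Implication (Fin (n + 1)))}

theorem mem_coneCandidates (hL : ∀ i, i ∈ L ↔ i ∈ dBase (coneSystem C B)) {F : Finset (Fin n)} :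
    F ∈ coneCandidates C L ↔ ∃ A, (A, 0) ∈ dBase (coneSystem C B) ∧ cl C (trace A) = F := by
  simp [coneCandidates, hL]

theorem nodup_coneDual (hC : IsClosureSystem C) (hs : IsStandard C) (hd : IsDistributive C)
    (hL : ∀ i, i ∈ L ↔ i ∈ dBase (coneSystem C B)) (hnd : L.Nodup) : (coneDual C L).Nodup := by
  refine List.Nodup.filter _ (List.Nodup.map_on ?_ (hnd.filter _))
  rintro ⟨A₁, c₁⟩ h₁ ⟨A₂, c₂⟩ h₂ h
  obtain ⟨h₁, h₁'⟩ := List.mem_filter.1 h₁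
  obtain ⟨h₂, h₂'⟩ := List.mem_filter.1 h₂
  obtain rfl : c₁ = 0 := by simpa using h₁'
  obtain rfl : c₂ = 0 := by simpa using h₂'
  rw [eq_of_mem_dBase_of_cl_trace_eq hC hs hd ((hL _).1 h₁) ((hL _).1 h₂) h]

/-- Every candidate lies outside the ideal and every minimal closed set outside is a candidate. The
filter is needed because an implication a → 0 may come from a cl(a) that is not minimal. -/
theorem mem_coneDual (hC : IsClosureSystem C) (hs : IsStandard C) (hd : IsDistributive C)
    (hne : B ≠ []) (hL : ∀ i, i ∈ L ↔ i ∈ dBase (coneSystem C B)) {F : Finset (Fin n)} :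
    F ∈ coneDual C L ↔ IsMinOutside C B F := by
  have hcand := fun F => mem_coneCandidates (F := F) hL
  simp only [coneDual, List.mem_filter, decide_eq_true_eq]
  constructor
  · rintro ⟨hF, hmin⟩
    obtain ⟨A, hA, rfl⟩ := (hcand F).1 hF
    refine ⟨hC.cl_mem _, not_cl_trace_subset_of_mem_dBase hC hA, fun F' hF' hsub hout => ?_⟩
    obtain ⟨H, hHF', hH⟩ := exists_isMinOutside hF' hout
    have := hmin H ((hcand H).2 (exists_mem_dBase_of_isMinOutside hC hs hd hne hH))
      (hHF'.trans hsub)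
    exact hsub.antisymm (this.trans hHF')
  · intro hF
    refine ⟨(hcand F).2 (exists_mem_dBase_of_isMinOutside hC hs hd hne hF), fun G hG hGF => ?_⟩
    obtain ⟨A, hA, rfl⟩ := (hcand G).1 hG
    exact (hF.2.2 _ (hC.cl_mem _) hGF (not_cl_trace_subset_of_mem_dBase hC hA)).symm.subset

/-- At most (n + 1)² implications have a singleton premise; the `D`-generators all belong to 0 and
map injectively to minimal closed sets outside the ideal. -/
theorem length_le_length_coneDual (hC : IsClosureSystem C) (hs : IsStandard C)
    (hd : IsDistributive C) (hne : B ≠ []) (hL : ∀ i, i ∈ L ↔ i ∈ dBase (coneSystem C B))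
    (hnd : L.Nodup) : L.length ≤ (n + 1) * (n + 1) + (coneDual C L).length := by
  classical
  rw [← List.toFinset_card_of_nodup hnd,
    ← List.toFinset_card_of_nodup (nodup_coneDual hC hs hd hL hnd)]
  have h₁ : L.toFinset ⊆ (Finset.univ.image fun x : Fin (n + 1) × Fin (n + 1) =>
      (({x.1}, x.2) : Implication (Fin (n + 1)))) ∪
      L.toFinset.filter fun i => IsDGen (coneSystem C B) i.1 i.2 := by
    rintro ⟨A, c⟩ hi
    rcases mem_dBase.1 ((hL _).1 (List.mem_toFinset.1 hi)) with ⟨a, -, -, rfl⟩ | h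
    · exact Finset.mem_union_left _ (Finset.mem_image.2 ⟨(a, c), Finset.mem_univ _, rfl⟩)
    · exact Finset.mem_union_right _ (Finset.mem_filter.2 ⟨hi, h⟩)
  refine (Finset.card_le_card h₁).trans ((Finset.card_union_le _ _).trans
    (Nat.add_le_add (Finset.card_image_le.trans (by simp)) ?_))
  refine Finset.card_le_card_of_injOn (fun i => cl C (trace i.1)) ?_ ?_
  · intro i hi
    have h := (Finset.mem_filter.1 hi).2
    exact List.mem_toFinset.2 ((mem_coneDual hC hs hd hne hL).2 (h.coneSystem hC hs hd).2)
  · rintro ⟨A₁, c₁⟩ h₁ ⟨A₂, c₂⟩ h₂ h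
    have h₁ : IsDGen (coneSystem C B) A₁ c₁ := (Finset.mem_filter.1 h₁).2
    have h₂ : IsDGen (coneSystem C B) A₂ c₂ := (Finset.mem_filter.1 h₂).2
    obtain rfl : c₁ = 0 := (h₁.coneSystem hC hs hd).1
    obtain rfl : c₂ = 0 := (h₂.coneSystem hC hs hd).1
    rw [eq_of_mem_dBase_of_cl_trace_eq hC hs hd (mem_dBase.2 (Or.inr h₁))
      (mem_dBase.2 (Or.inr h₂)) h]

end Cone

end ClosureSys

namespace DualInstance

/-- The closure system of the base. -/
abbrev system (i : DualInstance) : Finset (Finset (Fin i.n)) := closedSets i.base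

/-- The meet-irreducible elements of the cone system of a dualization instance. -/
def meetInstance (i : DualInstance) (h : i.Bp ≠ []) : MeetInstance where
  n := i.n + 1
  closedFamily := coneSystem i.system i.Bp
  isClosureSystem := (isClosureSystem_closedSets i.base).coneSystem i.Bp
  isStandard := i.isStandard.coneSystem (isClosureSystem_closedSets i.base) h
  meets := coneMeets i.system i.Bp
  meets_nodup := nodup_coneMeets i.isStandard i.Bp_nodup
  mem_meets _ := mem_coneMeets_iff (isClosureSystem_closedSets i.base) i.isStandard
    i.isDistributive i.isAntichain

end DualInstance

/-! ### The reduction to the `D`-base in polynomial time -/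

namespace WhileProg

open Polynomial

/-- The new point is 0 so that adjoining or deleting it changes only the head of a characteristic
vector. -/
theorem encSet_succ {n : ℕ} (F : Finset (Fin (n + 1))) :
    encSet F = .cons (encProp (0 ∈ F)) (encSet (trace F)) := by
  simp [encSet, List.ofFn_succ, encList, encBool_decide]

namespace PolyTime

variable {α : Type*} {sz : α → ℕ} {inp : α → Data}

theorem trace {n : α → ℕ} {F : ∀ a, Finset (Fin (n a + 1))}
    (hF : PolyTime sz inp fun a => encSet (F a)) :
    PolyTime sz inp fun a => encSet (ClosureSys.trace (F a)) :=
  hF.tail.congr fun a => by rw [encSet_succ]; rfl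

theorem shift {n : α → ℕ} {F : ∀ a, Finset (Fin (n a))}
    (hF : PolyTime sz inp fun a => encSet (F a)) :
    PolyTime sz inp fun a => encSet (ClosureSys.shift (F a)) :=
  (nil.cons hF).congr fun a => by
    rw [encSet_succ, encProp_of_false zero_notMem_shift, trace_shift]

theorem shiftZero {n : α → ℕ} {F : ∀ a, Finset (Fin (n a))}
    (hF : PolyTime sz inp fun a => encSet (F a)) :
    PolyTime sz inp fun a => encSet (ClosureSys.shiftZero (F a)) :=
  ((nil.cons nil).cons hF).congr fun a => by
    rw [encSet_succ, encProp_of_true zero_mem_shiftZero, trace_shiftZero]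

variable {i : α → DualInstance}

theorem dualInstance_n (hi : PolyTime sz inp fun a => distributiveDualization.encInst (i a)) :
    PolyTime sz inp fun a => encNat (i a).n :=
  hi.head

theorem dualInstance_base (hi : PolyTime sz inp fun a => distributiveDualization.encInst (i a)) :
    PolyTime sz inp fun a => encList ((i a).base.map encImplication) :=
  hi.tail.head

theorem dualInstance_Bp (hi : PolyTime sz inp fun a => distributiveDualization.encInst (i a)) :
    PolyTime sz inp fun a => encList ((i a).Bp.map encSet) :=
  hi.tail.tail

theorem chainStep (hi : PolyTime sz inp fun a => distributiveDualization.encInst (i a))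
    {F : ∀ a, Finset (Fin (i a).n)} (hF : PolyTime sz inp fun a => encSet (F a)) :
    PolyTime sz inp fun a => encSet (ClosureSys.chainStep (i a).base (F a)) := by
  refine set hi.dualInstance_n (((mem (n := fun z : (a : α) × Fin (i a).n => (i z.1).n)
    last hF.weak).or (exists_mem (p := fun (z : (a : α) × Fin (i a).n) j => j.1 ⊆ F z.1 ∧ j.2 = z.2)
      hi.weak.dualInstance_base ?_)).congr fun z => by simp [ClosureSys.chainStep])
  refine and (subset (n := fun z : (z : (a : α) × Fin (i a).n) × Implication (Fin (i z.1).n) =>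
    (i z.1.1).n) (A := fun z => z.2.1) hi.weak.weak.dualInstance_n last.head hF.weak.weak) ?_
  exact fin_eq (n := fun z : (z : (a : α) × Fin (i a).n) × Implication (Fin (i z.1).n) =>
    (i z.1.1).n) (i := fun z => z.2.2) (j := fun z => z.1.2) last.tail last.weak

theorem cl_system (hi : PolyTime sz inp fun a => distributiveDualization.encInst (i a))
    {A : ∀ a, Finset (Fin (i a).n)} (hA : PolyTime sz inp fun a => encSet (A a)) :
    PolyTime sz inp fun a => encSet (cl (i a).system (A a)) :=
  (iterate (F := fun a => ClosureSys.chainStep (i a).base) hi.dualInstance_n hi.dualInstance_n hA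
    (hi.weak.chainStep last)).congr fun a => by rw [iterate_chainStep]

theorem coneMeets (hi : PolyTime sz inp fun a => distributiveDualization.encInst (i a)) :
    PolyTime sz inp fun a =>
      encList ((ClosureSys.coneMeets (i a).system (i a).Bp).map encSet) := by
  refine ((map (L := fun a => List.finRange (i a).n) (e := fun a (x : Fin (i a).n) => encNat x)
    (G := fun a (x : Fin (i a).n) => encSet (ClosureSys.shiftZero (notAbove (i a).system x)))
      hi.dualInstance_n.finRange ?_).append (map (G := fun a (F : Finset (Fin (i a).n)) =>
        encSet (ClosureSys.shift F)) hi.dualInstance_Bp (shift last))).congr fun a => ?_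
  · refine shiftZero (n := fun z : (a : α) × Fin (i a).n => (i z.1).n)
      (set hi.weak.dualInstance_n (PolyTime.congr (f := fun z => encProp
        (¬ z.1.2 ∈ cl (i z.1.1).system {z.2})) (not ?_) fun z => by rw [mem_notAbove]))
    exact mem (n := fun z : (z : (a : α) × Fin (i a).n) × Fin (i z.1).n => (i z.1.1).n)
      (i := fun z => z.1.2) last.weak (hi.weak.weak.cl_system
        (singleton (n := fun z : (z : (a : α) × Fin (i a).n) × Fin (i z.1).n => (i z.1.1).n)
          (x := fun z => z.2) hi.weak.weak.dualInstance_n last))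
  · simp [ClosureSys.coneMeets, Function.comp_def]

theorem coneDual (hi : PolyTime sz inp fun a => distributiveDualization.encInst (i a))
    {L : ∀ a, List (Implication (Fin ((i a).n + 1)))}
    (hL : PolyTime sz inp fun a => encList ((L a).map encImplication)) :
    PolyTime sz inp fun a => encList ((ClosureSys.coneDual (i a).system (L a)).map encSet) := by
  have hcand : PolyTime sz inp fun a =>
      encList ((coneCandidates (i a).system (L a)).map encSet) := by
    refine (map (G := fun a (j : Implication (Fin ((i a).n + 1))) =>
      encSet (cl (i a).system (ClosureSys.trace j.1))) (filter (p := fun a j => j.2 = 0) hL ?_)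
      (hi.weak.cl_system (trace (n := fun z : (a : α) × Implication (Fin ((i a).n + 1)) =>
        (i z.1).n) (F := fun z => z.2.1) last.head))).congr fun a => ?_
    · exact (eq_nil (f := fun z : (a : α) × Implication (Fin ((i a).n + 1)) => encNat z.2.2)
        last.tail).congr fun z => by
          rcases z with ⟨a, A, c⟩
          cases c using Fin.cases <;> simp [encNat, encList, List.replicate_succ]
    · simp [coneCandidates, Function.comp_def]
  refine filter (p := fun a F => ∀ G ∈ coneCandidates (i a).system (L a), G ⊆ F → F ⊆ G)
    hcand ?_
  refine forall_mem (p := fun (z : (a : α) × Finset (Fin (i a).n)) G => G ⊆ z.2 → z.2 ⊆ G)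
    hcand.weak ?_
  have hn := hi.weak.weak.dualInstance_n (sz := extSize (extSize sz))
    (inp := extend (extend inp fun a (M : Finset (Fin (i a).n)) => encSet M)
      fun a (M : Finset (Fin (i a.1).n)) => encSet M)
  exact (subset hn last last.weak).imp (subset hn last.weak last)

end PolyTime

theorem outputPolynomial_dualization_of_dBase (h : dBaseFromMeetIrreducibles.OutputPolynomial) :
    distributiveDualization.OutputPolynomial := by
  classical
  rw [EnumProblem.outputPolynomial_iff] at h ⊢
  obtain ⟨L, hL, hP⟩ := h
  have hmem : ∀ i : {i : DualInstance // ¬ i.Bp = []}, ∀ j, j ∈ L (i.1.meetInstance i.2) ↔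
      j ∈ dBase (coneSystem i.1.system i.1.Bp) := fun i j =>
    Set.ext_iff.1 (hL (i.1.meetInstance i.2)).2 j
  have hnd := fun i : {i : DualInstance // ¬ i.Bp = []} => (hL (i.1.meetInstance i.2)).1
  let R : ∀ i : DualInstance, List (Finset (Fin i.n)) := fun i =>
    -- With no member of B⁺ every closed set is outside the ideal, and the empty set, closed by
    -- standardness, is the only minimal one.
    if h : i.Bp = [] then [∅] else coneDual i.system (L (i.meetInstance h))
  have hR : ∀ i : {i : DualInstance // ¬ i.Bp = []},
      R i.1 = coneDual i.1.system (L (i.1.meetInstance i.2)) := fun i => by simp [R, i.2]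
  refine ⟨R, fun i => ?_, ?_⟩
  · have hC := isClosureSystem_closedSets i.base
    change _ ∧ AreDual i.system {F | F ∈ R i} {F | F ∈ i.Bp}
    rw [areDual_iff i.isAntichain]
    by_cases h : i.Bp = []
    · have h₀ := hC.cl_mem ∅
      rw [i.isStandard.cl_empty] at h₀
      refine ⟨by simp only [R, h, dite_true]; exact List.nodup_singleton _, fun F => ?_⟩
      simp only [R, h, dite_true, Set.mem_ofPred_eq, List.mem_singleton, List.not_mem_nil]
      constructor
      · rintro rfl
        exact ⟨h₀, by simp, fun F' _ hF' _ => Finset.subset_empty.1 hF'⟩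
      · rintro ⟨-, -, hmin⟩
        exact (hmin ∅ h₀ (Finset.empty_subset F) (by simp)).symm
    · rw [hR ⟨i, h⟩]
      exact ⟨nodup_coneDual hC i.isStandard i.isDistributive (hmem ⟨i, h⟩) (hnd ⟨i, h⟩), fun F =>
        mem_coneDual hC i.isStandard i.isDistributive h (hmem ⟨i, h⟩)⟩
  · refine PolyTime.iteProp (p := fun i => i.Bp = []) ?_ ?_ ?_
    · refine PolyTime.id.dualInstance_Bp.eq_nil.congr fun i => ?_
      cases i.Bp <;> simp [encList]
    · refine (PolyTime.cons (PolyTime.set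
        (PolyTime.dualInstance_n (i := fun i : {i : DualInstance // i.Bp = []} => i.1) .id)
        (A := fun _ => ∅) ((PolyTime.true.not).congr fun z => by simp)) .nil).congr fun i => ?_
      simp [R, i.2, encList, distributiveDualization]
    · have hi : PolyTime (fun i : {i : DualInstance // ¬ i.Bp = []} =>
          (encList ((R i.1).map encSet)).size)
          (fun i => distributiveDualization.encInst i.1)
          fun i => distributiveDualization.encInst i.1 := .id
      have hinst : PolyTime (fun i : {i : DualInstance // ¬ i.Bp = []} =>
          (encList ((R i.1).map encSet)).size) (fun i => distributiveDualization.encInst i.1)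
          fun i => dBaseFromMeetIrreducibles.encInst (i.1.meetInstance i.2) :=
        (PolyTime.nil.cons hi.dualInstance_n).cons hi.coneMeets
      -- The factor `X * X + X` bounds the number of implications in the `D`-base, and `6 * X + 7`
      -- the nodes needed for each.
      refine (PolyTime.coneDual hi (hinst.comp ((hP.reindex
        fun i : {i : DualInstance // ¬ i.Bp = []} => i.1.meetInstance i.2).mono
          ((X * X + X) * (6 * X + 7) + 1) fun i => ?_))).congr fun i => ?_
      · have h₁ : i.1.n + 1 ≤
            (dBaseFromMeetIrreducibles.encInst (i.1.meetInstance i.2)).size := by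
          have := size_encNat (i.1.n + 1)
          simp only [dBaseFromMeetIrreducibles, DualInstance.meetInstance, Data.size]
          omega
        have h₂ := length_le_length_coneDual (isClosureSystem_closedSets i.1.base)
          i.1.isStandard i.1.isDistributive i.2 (hmem i) (hnd i)
        rw [← hR i] at h₂
        have h₃ := length_le_encList ((R i.1).map encSet)
        rw [List.length_map] at h₃
        refine (encList_size_le (m := 6 * (i.1.n + 1) + 3) fun d hd => ?_).trans ?_
        · obtain ⟨⟨A, c⟩, -, rfl⟩ := List.mem_map.1 hd
          have h₄ : (encSet A).size ≤ 4 * (i.1.n + 1) + 1 := size_encSet_le A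
          have h₅ := size_encNat c
          have h₆ : (c : ℕ) < i.1.n + 1 := c.2
          change (Data.cons (encSet A) (encNat c)).size ≤ _
          simp only [Data.size]
          omega
        · simp only [List.length_map, eval_add, eval_mul, eval_X, eval_ofNat, eval_one,
            Function.comp]
          refine Nat.add_le_add_right (Nat.mul_le_mul (le_trans h₂ (Nat.add_le_add
            (Nat.mul_le_mul ?_ ?_) ?_)) ?_) 1 <;> omega
      · rw [hR i]; rfl

end WhileProg

/-- The `D`-base of a standard closure system given by its meet-irreducible elements can be computed
in output-polynomial time if and only if dualization in distributive closure systems can be solved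
in output-polynomial time. -/
theorem theorem3 :
    dBaseFromMeetIrreducibles.OutputPolynomial ↔ distributiveDualization.OutputPolynomial := by
  exact ⟨outputPolynomial_dualization_of_dBase, outputPolynomial_dBase_of_dualization⟩
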